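/- Let $(M,g)$ be a (smooth, finite-dimensional, Hausdorff) Riemannian manifold, and let $\pi$ be a Poisson tensor on $M$, i.e. a smooth bivector field such that $\{f,h\}=\pi(df,dh)$ satisfies the Jacobi identity. Let $\pi_\#:T^*M\to TM$ be given by $\beta(\pi_\#(\alpha))=\pi(\alpha,\beta)$, let $$[\alpha,\beta]_\pi=L_{\pi_\#(\alpha)}\beta-L_{\pi_\#(\beta)}\alpha-d(\pi(\alpha,\beta))$$ be the Koszul bracket on 1-forms, and let $\langle\cdot,\cdot\rangle$ be the metric on covectors induced by $g$. Let $D$ be the metric contravariant connection of $(\pi,g)$: the unique map $(\alpha,\beta)\mapsto D_\alpha\beta$ on smooth 1-forms that is $C^\infty(M)$-linear in $\alpha$, $\mathbb R$-linear in $\beta$, and satisfies $D_\alpha(f\beta)=fD_\alpha\beta+\pi_\#(\alpha)(f)\,\beta$, $D_\alpha\beta-D_\beta\alpha=[\alpha,\beta]_\pi$ and $\pi_\#(\alpha)\cdot\langle\beta,\gamma\rangle=\langle D_\alpha\beta,\gamma\rangle+\langle\beta,D_\alpha\gamma\rangle$. Theorem 1.3. If $D\pi=0$, that is, $$\pi_\#(\alpha)\cdot\pi(\beta,\gamma)-\pi(D_\alpha\beta,\gamma)-\pi(\beta,D_\alpha\gamma)=0$$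 for all smooth 1-forms $\alpha,\beta,\gamma$ on $M$, then $\pi$ is a Killing–Poisson tensor, that is: 1. the divergence of $\pi$ with respect to the Levi-Civita connection $\nabla$ of $g$ vanishes: $\sum_i(\nabla_{e_i}\pi)(e^i,\beta)=0$ at every point $x$ and for every smooth 1-form $\beta$, where $(e_i)$ is an orthonormal basis of $T_xM$ and $(e^i)$ the dual basis; 2. for every open set $U\subset M$ and every $f\in C^\infty(U)$ that is a Casimir function on $U$ (i.e. $\pi_\#(df)=0$ on $U$), the gradient vector field $\nabla f$ preserves $\pi$: $L_{\nabla f}\pi=0$ on $U$. -/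

import Mathlib

open Bundle
open scoped Manifold ContDiff

namespace KillingPoisson

noncomputable section

section Smooth

variable {E : Type*} [NormedAddCommGroup E] [NormedSpace ℝ E] [FiniteDimensional ℝ E]
  {M : Type*} [TopologicalSpace M] [ChartedSpace E M] [IsManifold 𝓘(ℝ, E) ∞ M]

variable (E M) in
/-- (Not necessarily smooth) vector fields on `M`. -/
abbrev VField := Π x : M, TangentSpace 𝓘(ℝ, E) x

variable (E M) in
/-- (Not necessarily smooth) 1-forms on `M`. -/
abbrev OneForm := Π x : M, TangentSpace 𝓘(ℝ, E) x →L[ℝ] ℝ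

/-- The 1-form `α` is smooth on the set `U`, as a section of the bundle `T*M`. -/
def SmoothFormOn (α : OneForm E M) (U : Set M) : Prop :=
  ContMDiffOn 𝓘(ℝ, E) (𝓘(ℝ, E).prod 𝓘(ℝ, E →L[ℝ] ℝ)) ∞
    (fun x ↦ TotalSpace.mk' (E →L[ℝ] ℝ)
      (E := fun x : M ↦ TangentSpace 𝓘(ℝ, E) x →L[ℝ] ℝ) x (α x)) U

/-- The differential `df` of a real function. -/
abbrev differential (f : M → ℝ) : OneForm E M := mvfderiv 𝓘(ℝ, E) f

/-- The covector at `x` defined by an operation `φ` on vector fields which is tensorial at `x`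
(additive, and linear over germs of functions): it is characterized by `formAt φ x (Y x) = φ Y`
for `Y` differentiable at `x`. The default value `0` is irrelevant: below, `φ` is tensorial
whenever its ingredients are differentiable at `x`. -/
def formAt (φ : VField E M → ℝ) (x : M) : TangentSpace 𝓘(ℝ, E) x →L[ℝ] ℝ :=
  open Classical in
  if h : TensorialAt 𝓘(ℝ, E) E φ x then TensorialAt.mkHom φ x h else 0

/-- The Lie derivative of a 1-form: `(L_X β)(Y) = X(β(Y)) - β([X, Y])`. -/
def lieDerivForm (X : VField E M) (β : OneForm E M) : OneForm E M := fun x ↦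
  formAt (fun Y ↦ differential (fun y ↦ β y (Y y)) x (X x)
    - β x (VectorField.mlieBracket 𝓘(ℝ, E) X Y x)) x

variable (E M) in
/-- A Poisson tensor on `M`: a smooth bivector field `π`, such that the bracket
`{f, g} = π(df, dg)` satisfies the Jacobi identity. The bivector field is encoded by its anchor map
`π_# : T*M → TM`, where `π(α, β) = β(π_# α)`; it is a bivector since `π(α, β) = - π(β, α)`. -/
structure PoissonTensor where
  /-- The anchor map `π_# : T*M → TM`. -/
  sharp : Π x : M, (TangentSpace 𝓘(ℝ, E) x →L[ℝ] ℝ) →L[ℝ] TangentSpace 𝓘(ℝ, E) x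
  antisymm : ∀ (x : M) (a b : TangentSpace 𝓘(ℝ, E) x →L[ℝ] ℝ), b (sharp x a) = - a (sharp x b)
  smooth : ContMDiff 𝓘(ℝ, E) (𝓘(ℝ, E).prod 𝓘(ℝ, (E →L[ℝ] ℝ) →L[ℝ] E)) ∞
    (fun x ↦ TotalSpace.mk' ((E →L[ℝ] ℝ) →L[ℝ] E)
      (E := fun x : M ↦ (TangentSpace 𝓘(ℝ, E) x →L[ℝ] ℝ) →L[ℝ] TangentSpace 𝓘(ℝ, E) x)
      x (sharp x))
  jacobi : ∀ f g h : M → ℝ, ContMDiff 𝓘(ℝ, E) 𝓘(ℝ) ∞ f → ContMDiff 𝓘(ℝ, E) 𝓘(ℝ) ∞ g →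
    ContMDiff 𝓘(ℝ, E) 𝓘(ℝ) ∞ h →
    letI br (u v : M → ℝ) : M → ℝ := fun x ↦ differential v x (sharp x (differential u x))
    ∀ x, br f (br g h) x + br g (br h f) x + br h (br f g) x = 0

namespace PoissonTensor

variable (P : PoissonTensor E M)

/-- The anchor applied to a 1-form: the vector field `π_#(α)`. -/
def anchor (α : OneForm E M) : VField E M := fun x ↦ P.sharp x (α x)

/-- The function `π(α, β) = β(π_#(α))`. -/
def pair (α β : OneForm E M) : M → ℝ := fun x ↦ β x (P.anchor α x)

/-- The Koszul bracket `[α, β]_π = L_{π_# α} β - L_{π_# β} α - d(π(α, β))`. -/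
def koszulBracket (α β : OneForm E M) : OneForm E M := fun x ↦
  lieDerivForm (P.anchor α) β x - lieDerivForm (P.anchor β) α x - differential (P.pair α β) x

/-- The Lie derivative of the bivector field,
`(L_X π)(β, γ) = X(π(β, γ)) - π(L_X β, γ) - π(β, L_X γ)`. -/
def lieDeriv (X : VField E M) (β γ : OneForm E M) : M → ℝ := fun x ↦
  differential (P.pair β γ) x (X x) - P.pair (lieDerivForm X β) γ x - P.pair β (lieDerivForm X γ) x

/-- `f` is a Casimir function on the open set `U`: its Hamiltonian vector field `π_#(df)` vanishes
on `U` (equivalently `i_{df} π = 0`). -/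
def IsCasimirOn (f : M → ℝ) (U : Set M) : Prop :=
  ∀ x ∈ U, P.anchor (differential f) x = 0

end PoissonTensor

end Smooth

section Riemannian

variable {E : Type*} [NormedAddCommGroup E] [NormedSpace ℝ E] [FiniteDimensional ℝ E]
  {M : Type*} [TopologicalSpace M] [ChartedSpace E M] [IsManifold 𝓘(ℝ, E) ∞ M]
  [RiemannianBundle (fun x : M ↦ TangentSpace 𝓘(ℝ, E) x)]

instance finiteDimensional_tangentSpace (x : M) : FiniteDimensional ℝ (TangentSpace 𝓘(ℝ, E) x) :=
  inferInstanceAs (FiniteDimensional ℝ E)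

/-- The 1-form `g(Y, ·)` associated to a vector field `Y`. -/
def flat (Y : VField E M) : OneForm E M := fun x ↦ innerSL ℝ (Y x)

/-- The vector field `#(α)` associated to a 1-form `α` by the metric: `g(#(α), v) = α(v)`. -/
def metricSharp (α : OneForm E M) : VField E M := fun x ↦
  haveI : CompleteSpace (TangentSpace 𝓘(ℝ, E) x) := FiniteDimensional.complete ℝ _
  (InnerProductSpace.toDual ℝ (TangentSpace 𝓘(ℝ, E) x)).symm (α x)

/-- The metric on 1-forms, `⟨α, β⟩ = g(#(α), #(β))`. -/
def coInner (α β : OneForm E M) : M → ℝ := fun x ↦ inner ℝ (metricSharp α x) (metricSharp β x)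

/-- The gradient `∇f` of a function: `g(∇f, Y) = df(Y)`. -/
def gradient (f : M → ℝ) : VField E M := metricSharp (differential f)

/-- Right-hand side of the Koszul formula for `2 g(∇_X Y, Z)`. -/
def leviCivitaKoszul (X Y Z : VField E M) : M → ℝ := fun x ↦
  differential (fun y ↦ inner ℝ (Y y) (Z y)) x (X x)
  + differential (fun y ↦ inner ℝ (X y) (Z y)) x (Y x)
  - differential (fun y ↦ inner ℝ (X y) (Y y)) x (Z x)
  + inner ℝ (VectorField.mlieBracket 𝓘(ℝ, E) X Y x) (Z x)
  - inner ℝ (VectorField.mlieBracket 𝓘(ℝ, E) X Z x) (Y x)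
  - inner ℝ (VectorField.mlieBracket 𝓘(ℝ, E) Y Z x) (X x)

/-- The Levi-Civita connection `∇_X Y` on vector fields, given by the Koszul formula. -/
def leviCivita (X Y : VField E M) : VField E M :=
  metricSharp fun x ↦ formAt (fun Z ↦ (1 / 2 : ℝ) * leviCivitaKoszul X Y Z x) x

/-- The Levi-Civita connection on 1-forms: `(∇_X α)(Y) = X(α(Y)) - α(∇_X Y)`. -/
def leviCivitaForm (X : VField E M) (α : OneForm E M) : OneForm E M := fun x ↦
  formAt (fun Y ↦ differential (fun y ↦ α y (Y y)) x (X x) - α x (leviCivita X Y x)) x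

namespace PoissonTensor

variable (P : PoissonTensor E M)

/-- The covariant derivative of the bivector field,
`(∇_X π)(α, β) = X(π(α, β)) - π(∇_X α, β) - π(α, ∇_X β)`. -/
def covDeriv (X : VField E M) (α β : OneForm E M) : M → ℝ := fun x ↦
  differential (P.pair α β) x (X x)
    - P.pair (leviCivitaForm X α) β x - P.pair α (leviCivitaForm X β) x

/-- The divergence of `π` with respect to the Levi-Civita connection, that is, the vector field
`c(∇π)`, evaluated on a 1-form `β`: `(div π)(β) = ∑ i, (∇_{e_i} π)(e^i, β)` at `x`, where `(e_i)`
is an orthonormal basis of `T_x M`, with dual basis `e^i = g(e_i, ·)`, and both are extended to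
smooth fields near `x`. -/
def divergence (β : OneForm E M) : M → ℝ := fun x ↦
  let e := stdOrthonormalBasis ℝ (TangentSpace 𝓘(ℝ, E) x)
  ∑ i, P.covDeriv (FiberBundle.extend E (e i)) (flat (FiberBundle.extend E (e i))) β x

/-- Right-hand side of the Koszul formula for `2 ⟨D_α β, γ⟩`. -/
def contravariantKoszul (α β γ : OneForm E M) : M → ℝ := fun x ↦
  differential (coInner β γ) x (P.anchor α x)
  + differential (coInner α γ) x (P.anchor β x)
  - differential (coInner α β) x (P.anchor γ x)
  + coInner (P.koszulBracket γ α) β x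
  + coInner (P.koszulBracket γ β) α x
  + coInner (P.koszulBracket α β) γ x

/-- The metric contravariant connection `D_α β` of `π` and the Riemannian metric, given by the
Koszul formula. It is the torsion-free contravariant connection for which the metric is parallel.
The covector `D_α β` is determined by `(D_α β)(Y) = ⟨D_α β, g(Y, ·)⟩`. -/
def contravariantConnection (α β : OneForm E M) : OneForm E M := fun x ↦
  formAt (fun Y ↦ (1 / 2 : ℝ) * P.contravariantKoszul α β (flat Y) x) x

/-- `Dπ = 0`: the Poisson tensor is parallel for the metric contravariant connection, i.e.
`π_#(α)(π(β, γ)) - π(D_α β, γ) - π(β, D_α γ) = 0` for all smooth 1-forms. -/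
def IsParallel : Prop :=
  ∀ α β γ : OneForm E M, SmoothFormOn α Set.univ → SmoothFormOn β Set.univ →
    SmoothFormOn γ Set.univ → ∀ x,
      differential (P.pair β γ) x (P.anchor α x)
        - P.pair (P.contravariantConnection α β) γ x
        - P.pair β (P.contravariantConnection α γ) x = 0

/-- Killing-Poisson tensors: the Levi-Civita divergence vanishes, and `L_{∇f} π = 0` on `U` for
every open set `U` and every Casimir function `f` on `U`. (A function or form on `U` is represented
by an arbitrary extension to `M`; only its germs at points of `U` matter.) -/
structure IsKillingPoisson : Prop where
  divergence_eq_zero : ∀ β : OneForm E M, SmoothFormOn β Set.univ → ∀ x, P.divergence β x = 0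
  lieDeriv_gradient_eq_zero : ∀ (U : Set M) (f : M → ℝ), IsOpen U →
    ContMDiffOn 𝓘(ℝ, E) 𝓘(ℝ) ∞ f U → P.IsCasimirOn f U →
    ∀ β γ : OneForm E M, SmoothFormOn β U → SmoothFormOn γ U →
      ∀ x ∈ U, P.lieDeriv (gradient f) β γ x = 0

end PoissonTensor

end Riemannian

end

end KillingPoisson

open Filter Topology

set_option linter.unusedSectionVars false

/-! Both conclusions are tensorial, so they may be tested on exact forms: every covector at a point
is the differential of a globally smooth function. On exact forms the Koszul formula expresses `D`
through the functions `{f,g}` and `⟨df,dg⟩` alone (`two_mul_conn`). The resulting quantities are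
continuous in the point, so it is enough that they vanish at regular points, where the rank of `π`
is locally maximal. Such points are dense, since the rank takes finitely many values
(`frequently_isRegularAt`, `eq_zero_of_isRegularAt`).

The heart is `IsParallel.conn_eq_zero`: at a regular point `D_α = 0` for every `α` in `ker π_#`.
Parallelism, vanishing torsion and the Jacobi identity show that `D_α` takes values in `ker π_#`.
Metricity makes `D_α` skew-adjoint there, because `π_#(α) = 0`. On three covectors of `ker π_#`
every term of the Koszul formula vanishes, since the isotropy Lie algebra `ker π_#` is abelian at a
regular point (`IsRegularAt.abelianIsotropy`). So `D_α` kills `ker π_#`, and a skew endomorphism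
with values in a subspace that it kills is zero.

If `f` is a Casimir function, `L_{∇f} π (db, dc) = -2 ⟨D_{df} db, dc⟩`, and `df` lies in `ker π_#`,
which gives the second conclusion.

For the first, `(div π)(db)` is the trace of `T : α ↦ D_α db`: the difference is a contraction of
the symmetric Hessian of `b` with the antisymmetric `π` (`divergence_eq_sum_conn`). Parallelism
makes `(α, β) ↦ (D_α db)(π_# β)` symmetric, and `T` vanishes on `ker π_#` at regular points. Linear
algebra then forces the trace to vanish (`trace_eq_zero_of_isSymm_mul`). -/

namespace KillingPoisson

noncomputable section

/-! ### Smooth 1-forms, and covectors defined by tensorial operations -/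

section Smooth

variable {E : Type*} [NormedAddCommGroup E] [NormedSpace ℝ E] [FiniteDimensional ℝ E]
  {M : Type*} [TopologicalSpace M] [ChartedSpace E M] [IsManifold 𝓘(ℝ, E) ∞ M]

/-- The 1-form `α` is `C^∞` at the point `x`. -/
abbrev SmoothFormAt (α : OneForm E M) (x : M) : Prop :=
  ContMDiffAt 𝓘(ℝ, E) (𝓘(ℝ, E).prod 𝓘(ℝ, E →L[ℝ] ℝ)) ∞
    (fun x ↦ TotalSpace.mk' (E →L[ℝ] ℝ)
      (E := fun x : M ↦ TangentSpace 𝓘(ℝ, E) x →L[ℝ] ℝ) x (α x)) x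

/-- The 1-form `α` is differentiable at the point `x`. -/
abbrev FormMDiffAt (α : OneForm E M) (x : M) : Prop :=
  MDifferentiableAt 𝓘(ℝ, E) (𝓘(ℝ, E).prod 𝓘(ℝ, E →L[ℝ] ℝ))
    (fun x ↦ TotalSpace.mk' (E →L[ℝ] ℝ)
      (E := fun x : M ↦ TangentSpace 𝓘(ℝ, E) x →L[ℝ] ℝ) x (α x)) x

theorem SmoothFormAt.mdiffAt {α : OneForm E M} {x : M} (h : SmoothFormAt α x) : FormMDiffAt α x :=
  h.mdifferentiableAt (by simp)

theorem SmoothFormAt.apply {α : OneForm E M} {X : VField E M} {x : M}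
    (hα : SmoothFormAt α x) (hX : CMDiffAt ∞ (T% X) x) : CMDiffAt ∞ (fun y ↦ α y (X y)) x := by
  have := ContMDiffAt.clm_bundle_apply (F₁ := E) (F₂ := ℝ) (E₂ := Bundle.Trivial M ℝ) hα hX
  simp only [contMDiffAt_totalSpace] at this
  exact this.2

theorem FormMDiffAt.apply {α : OneForm E M} {X : VField E M} {x : M}
    (hα : FormMDiffAt α x) (hX : MDiffAt (T% X) x) : MDiffAt (fun y ↦ α y (X y)) x := by
  have := MDifferentiableAt.clm_bundle_apply (F₁ := E) (F₂ := ℝ) (E₂ := Bundle.Trivial M ℝ) hα hX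
  simp only [mdifferentiableAt_totalSpace] at this
  exact this.2

theorem smoothFormAt_differential {f : M → ℝ} {x : M} (hf : CMDiffAt ∞ f x) :
    SmoothFormAt (differential f : OneForm E M) x := by
  have := hf.mfderiv_const (m := ∞) (by simp)
  rw [SmoothFormAt, contMDiffAt_hom_bundle]
  refine ⟨contMDiffAt_id, ?_⟩
  refine this.congr_of_eventuallyEq ?_
  filter_upwards with y
  ext v
  simp [inTangentCoordinates, ContinuousLinearMap.inCoordinates, mvfderiv]
  rfl

variable (P : PoissonTensor E M)

theorem PoissonTensor.contMDiffAt_anchor {α : OneForm E M} {x : M} (h : SmoothFormAt α x) :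
    CMDiffAt ∞ (T% (P.anchor α)) x :=
  ContMDiffAt.clm_bundle_apply (F₁ := E →L[ℝ] ℝ) (F₂ := E)
    (E₁ := fun x : M ↦ TangentSpace 𝓘(ℝ, E) x →L[ℝ] ℝ)
    (E₂ := fun x : M ↦ TangentSpace 𝓘(ℝ, E) x) P.smooth.contMDiffAt h

theorem PoissonTensor.mdiffAt_anchor {α : OneForm E M} {x : M} (h : FormMDiffAt α x) :
    MDiffAt (T% (P.anchor α)) x :=
  MDifferentiableAt.clm_bundle_apply (F₁ := E →L[ℝ] ℝ) (F₂ := E)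
    (E₁ := fun x : M ↦ TangentSpace 𝓘(ℝ, E) x →L[ℝ] ℝ)
    (E₂ := fun x : M ↦ TangentSpace 𝓘(ℝ, E) x) (P.smooth.contMDiffAt.mdifferentiableAt (by simp)) h

/-- A closed formula depending only on `Y x` already implies tensoriality, so exact forms need no
separate tensoriality check. -/
theorem formAt_eq {φ : VField E M → ℝ} {x : M} (l : TangentSpace 𝓘(ℝ, E) x →L[ℝ] ℝ)
    (h : ∀ Y : VField E M, MDiffAt (T% Y) x → φ Y = l (Y x)) : formAt φ x = l := by
  have ht : TensorialAt 𝓘(ℝ, E) E φ x := by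
    constructor
    · intro f σ hf hσ
      rw [h _ (hf.smul_section hσ), h _ hσ]
      simp
    · intro σ τ hσ hτ
      rw [h _ (mdifferentiableAt_add_section hσ hτ), h _ hσ, h _ hτ]
      simp
  ext v
  rw [formAt, dif_pos ht, TensorialAt.mkHom_apply_eq_extend,
    h _ (FiberBundle.mdifferentiableAt_extend ..)]
  simp

theorem formAt_apply {φ : VField E M → ℝ} {x : M} (ht : TensorialAt 𝓘(ℝ, E) E φ x)
    {Y : VField E M} (hY : MDiffAt (T% Y) x) : formAt φ x (Y x) = φ Y := by
  rw [formAt, dif_pos ht, TensorialAt.mkHom_apply ht hY]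

end Smooth

/-! ### Metric duality between vector fields and 1-forms -/

section Riemannian

variable {E : Type*} [NormedAddCommGroup E] [NormedSpace ℝ E] [FiniteDimensional ℝ E]
  {M : Type*} [TopologicalSpace M] [ChartedSpace E M] [IsManifold 𝓘(ℝ, E) ∞ M]
  [RiemannianBundle (fun x : M ↦ TangentSpace 𝓘(ℝ, E) x)]

theorem inner_metricSharp (α : OneForm E M) (x : M) (v : TangentSpace 𝓘(ℝ, E) x) :
    inner ℝ (metricSharp α x) v = α x v := by
  have : CompleteSpace (TangentSpace 𝓘(ℝ, E) x) := FiniteDimensional.complete ℝ _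
  exact InnerProductSpace.toDual_symm_apply

theorem coInner_eq (α β : OneForm E M) (x : M) : coInner α β x = α x (metricSharp β x) := by
  rw [coInner, inner_metricSharp]

theorem coInner_comm (α β : OneForm E M) : coInner α β = coInner β α := by
  funext x
  exact real_inner_comm _ _

theorem flat_apply (Y : VField E M) (x : M) (v : TangentSpace 𝓘(ℝ, E) x) :
    flat Y x v = inner ℝ (Y x) v := rfl

theorem metricSharp_flat (Y : VField E M) : metricSharp (flat Y) = Y := by
  funext x
  refine ext_inner_right ℝ fun v ↦ ?_
  rw [inner_metricSharp, flat_apply]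

variable [IsContMDiffRiemannianBundle 𝓘(ℝ, E) ∞ E (fun x : M ↦ TangentSpace 𝓘(ℝ, E) x)]

theorem formMDiffAt_flat {Y : VField E M} {x : M} (hY : MDiffAt (T% Y) x) :
    FormMDiffAt (flat Y) x := by
  obtain ⟨g, hg, hgi⟩ := IsContMDiffRiemannianBundle.exists_contMDiff (IB := 𝓘(ℝ, E)) (n := ∞)
    (F := E) (E := fun x : M ↦ TangentSpace 𝓘(ℝ, E) x)
  have h : flat Y = fun x ↦ g x (Y x) := by
    funext x
    ext v
    rw [flat_apply, hgi]
  rw [h]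
  exact MDifferentiableAt.clm_bundle_apply (F₁ := E) (F₂ := E →L[ℝ] ℝ)
    (E₂ := fun x : M ↦ TangentSpace 𝓘(ℝ, E) x →L[ℝ] ℝ)
    ((hg x).mdifferentiableAt (by simp)) hY

end Riemannian

section HomBundle

variable {n : WithTop ℕ∞} {B F₁ F₂ : Type*}
  {E₁ : B → Type*} [∀ x, AddCommGroup (E₁ x)] [∀ x, Module ℝ (E₁ x)]
  [NormedAddCommGroup F₁] [NormedSpace ℝ F₁] [CompleteSpace F₁]
  [TopologicalSpace (TotalSpace F₁ E₁)] [∀ x, TopologicalSpace (E₁ x)]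
  {E₂ : B → Type*} [∀ x, AddCommGroup (E₂ x)] [∀ x, Module ℝ (E₂ x)]
  [NormedAddCommGroup F₂] [NormedSpace ℝ F₂]
  [TopologicalSpace (TotalSpace F₂ E₂)] [∀ x, TopologicalSpace (E₂ x)]
  {EB : Type*} [NormedAddCommGroup EB] [NormedSpace ℝ EB] {HB : Type*} [TopologicalSpace HB]
  {IB : ModelWithCorners ℝ EB HB} [TopologicalSpace B] [ChartedSpace HB B]
  [FiberBundle F₁ E₁] [VectorBundle ℝ F₁ E₁] [FiberBundle F₂ E₂] [VectorBundle ℝ F₂ E₂]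
  [∀ x, IsTopologicalAddGroup (E₁ x)] [∀ x, ContinuousSMul ℝ (E₁ x)]
  [∀ x, IsTopologicalAddGroup (E₂ x)] [∀ x, ContinuousSMul ℝ (E₂ x)]

/-- The inverse of a smooth family of invertible maps between vector bundles is smooth. -/
theorem contMDiffAt_clm_bundle_inverse {φ : ∀ x, E₁ x →L[ℝ] E₂ x} {x : B}
    (hφ : ContMDiffAt IB (IB.prod 𝓘(ℝ, F₁ →L[ℝ] F₂)) n
      (fun x ↦ TotalSpace.mk' (F₁ →L[ℝ] F₂) (E := fun x ↦ E₁ x →L[ℝ] E₂ x) x (φ x)) x)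
    (hinv : ∀ x, (φ x).IsInvertible) :
    ContMDiffAt IB (IB.prod 𝓘(ℝ, F₂ →L[ℝ] F₁)) n
      (fun x ↦ TotalSpace.mk' (F₂ →L[ℝ] F₁) (E := fun x ↦ E₂ x →L[ℝ] E₁ x) x (φ x).inverse) x := by
  rw [contMDiffAt_hom_bundle] at hφ ⊢
  refine ⟨contMDiffAt_id, ?_⟩
  have key : ∀ᶠ y in 𝓝 x, y ∈ (trivializationAt F₁ E₁ x).baseSet :=
    (trivializationAt F₁ E₁ x).open_baseSet.mem_nhds (FiberBundle.mem_baseSet_trivializationAt' x)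
  have key2 : ∀ᶠ y in 𝓝 x, y ∈ (trivializationAt F₂ E₂ x).baseSet :=
    (trivializationAt F₂ E₂ x).open_baseSet.mem_nhds (FiberBundle.mem_baseSet_trivializationAt' x)
  have hinvcoord : ∀ y, y ∈ (trivializationAt F₁ E₁ x).baseSet →
      y ∈ (trivializationAt F₂ E₂ x).baseSet →
      (ContinuousLinearMap.inCoordinates F₁ E₁ F₂ E₂ x y x y (φ y)).IsInvertible ∧
      ContinuousLinearMap.inCoordinates F₂ E₂ F₁ E₁ x y x y (φ y).inverse =
        (ContinuousLinearMap.inCoordinates F₁ E₁ F₂ E₂ x y x y (φ y)).inverse := by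
    intro y h1 h2
    obtain ⟨G, hG⟩ := hinv y
    rw [ContinuousLinearMap.inCoordinates_eq h1 h2, ContinuousLinearMap.inCoordinates_eq h2 h1,
      ← hG]
    refine ⟨⟨((Trivialization.continuousLinearEquivAt ℝ _ y h1).symm.trans G).trans
      (Trivialization.continuousLinearEquivAt ℝ _ y h2), rfl⟩, ?_⟩
    rw [ContinuousLinearMap.inverse_equiv]
    exact (ContinuousLinearMap.inverse_equiv
      (((Trivialization.continuousLinearEquivAt ℝ _ y h1).symm.trans G).trans
      (Trivialization.continuousLinearEquivAt ℝ _ y h2))).symm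
  have hc := ((hinvcoord x key.self_of_nhds key2.self_of_nhds).1.contDiffAt_map_inverse
    (n := n)).contMDiffAt.comp x hφ.2
  refine hc.congr_of_eventuallyEq ?_
  filter_upwards [key, key2] with y h1 h2
  exact (hinvcoord y h1 h2).2

end HomBundle

section Riemannian

variable {E : Type*} [NormedAddCommGroup E] [NormedSpace ℝ E] [FiniteDimensional ℝ E]
  {M : Type*} [TopologicalSpace M] [ChartedSpace E M] [IsManifold 𝓘(ℝ, E) ∞ M]
  [RiemannianBundle (fun x : M ↦ TangentSpace 𝓘(ℝ, E) x)]

variable [IsContMDiffRiemannianBundle 𝓘(ℝ, E) ∞ E (fun x : M ↦ TangentSpace 𝓘(ℝ, E) x)]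

/-- The sharp map is the fibrewise inverse of the smooth bundle map `TM → T*M` given by the metric.
That map is invertible by positive definiteness and equality of dimensions. -/
theorem SmoothFormAt.metricSharp {α : OneForm E M} {x : M} (hα : SmoothFormAt α x) :
    CMDiffAt ∞ (T% (KillingPoisson.metricSharp α)) x := by
  obtain ⟨g, hg, hgi⟩ := IsContMDiffRiemannianBundle.exists_contMDiff (IB := 𝓘(ℝ, E)) (n := ∞)
    (F := E) (E := fun x : M ↦ TangentSpace 𝓘(ℝ, E) x)
  have hginv (y : M) : (g y).IsInvertible := by
    have hinj : Function.Injective (g y).toLinearMap := by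
      rw [← LinearMap.ker_eq_bot, LinearMap.ker_eq_bot']
      intro v hv
      have : inner ℝ v v = (0 : ℝ) := by
        rw [hgi]
        exact congrArg (fun l ↦ l v) hv
      exact inner_self_eq_zero.1 this
    have hdim : Module.finrank ℝ (TangentSpace 𝓘(ℝ, E) y) =
        Module.finrank ℝ (TangentSpace 𝓘(ℝ, E) y →L[ℝ] ℝ) := by
      rw [← Subspace.dual_finrank_eq]
      exact LinearEquiv.finrank_eq LinearMap.toContinuousLinearMap
    have hfd : FiniteDimensional ℝ (TangentSpace 𝓘(ℝ, E) y →L[ℝ] ℝ) :=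
      LinearEquiv.finiteDimensional (LinearMap.toContinuousLinearMap (𝕜 := ℝ)
        (E := TangentSpace 𝓘(ℝ, E) y) (F' := ℝ))
    exact ⟨(LinearEquiv.ofInjectiveOfFinrankEq _ hinj hdim).toContinuousLinearEquiv, by ext v; rfl⟩
  have hsharp (y : M) : KillingPoisson.metricSharp α y = (g y).inverse (α y) := by
    obtain ⟨v, hv⟩ := (hginv y).bijective.2 (α y)
    have : (g y).inverse (α y) = v := by
      rw [← hv]
      exact congrArg (fun l ↦ l v) (hginv y).inverse_comp_self
    rw [this]
    refine ext_inner_right ℝ fun w ↦ ?_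
    rw [inner_metricSharp, hgi, hv]
  simp_rw [hsharp]
  exact ContMDiffAt.clm_bundle_apply (F₁ := E →L[ℝ] ℝ) (F₂ := E)
    (E₁ := fun x : M ↦ TangentSpace 𝓘(ℝ, E) x →L[ℝ] ℝ)
    (E₂ := fun x : M ↦ TangentSpace 𝓘(ℝ, E) x) (contMDiffAt_clm_bundle_inverse (hg x) hginv) hα

end Riemannian

/-! ### The Lie bracket as a commutator of derivations, computed in a chart -/

section Smooth

variable {E : Type*} [NormedAddCommGroup E] [NormedSpace ℝ E] [FiniteDimensional ℝ E]
  {M : Type*} [TopologicalSpace M] [ChartedSpace E M] [IsManifold 𝓘(ℝ, E) ∞ M]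

/-- The expression of a vector field in the chart at `x`. -/
def chartField (X : VField E M) (x : M) : E → E :=
  VectorField.mpullbackWithin 𝓘(ℝ, E) 𝓘(ℝ, E) (extChartAt 𝓘(ℝ, E) x).symm X
    (Set.range 𝓘(ℝ, E))

theorem differentiableAt_chartField {X : VField E M} {x : M} (hX : MDiffAt (T% X) x) :
    DifferentiableAt ℝ (chartField X x) (extChartAt 𝓘(ℝ, E) x x) := by
  have := FiniteDimensional.complete ℝ E
  have h : DifferentiableWithinAt ℝ (chartField X x)
      ((extChartAt 𝓘(ℝ, E) x).symm ⁻¹' Set.univ ∩ Set.range 𝓘(ℝ, E)) (extChartAt 𝓘(ℝ, E) x x) :=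
    MDifferentiableWithinAt.differentiableWithinAt_mpullbackWithin_vectorField
      (I := 𝓘(ℝ, E)) (V := X) (s := Set.univ) hX.mdifferentiableWithinAt
  rwa [Set.preimage_univ, Set.univ_inter, ModelWithCorners.range_eq_univ,
    differentiableWithinAt_univ] at h

theorem differential_eq_chart {h : M → ℝ} {x : M} {z : E}
    (hz : z ∈ (extChartAt 𝓘(ℝ, E) x).target)
    (hh : MDiffAt h ((extChartAt 𝓘(ℝ, E) x).symm z)) (X : VField E M) :
    differential h ((extChartAt 𝓘(ℝ, E) x).symm z) (X ((extChartAt 𝓘(ℝ, E) x).symm z)) =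
      fderiv ℝ (h ∘ (extChartAt 𝓘(ℝ, E) x).symm) z (chartField X x z) := by
  have hi := isInvertible_mfderivWithin_extChartAt_symm (I := 𝓘(ℝ, E)) hz
  have hd : MDifferentiableAt 𝓘(ℝ, E) 𝓘(ℝ, E) (extChartAt 𝓘(ℝ, E) x).symm z :=
    (contMDiffOn_extChartAt_symm (n := 1) x).mdifferentiableOn (by simp) z hz |>.mdifferentiableAt
      ((isOpen_extChartAt_target x).mem_nhds hz)
  rw [ModelWithCorners.range_eq_univ, mfderivWithin_univ] at hi
  rw [← mfderiv_eq_fderiv, mfderiv_comp z hh hd, chartField, ModelWithCorners.range_eq_univ,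
    VectorField.mpullbackWithin_apply, mfderivWithin_univ]
  change _ = mfderiv 𝓘(ℝ, E) 𝓘(ℝ, ℝ) h _ (mfderiv 𝓘(ℝ, E) 𝓘(ℝ, E) _ z (_))
  rw [← ContinuousLinearMap.comp_apply (mfderiv 𝓘(ℝ, E) 𝓘(ℝ, E) (extChartAt 𝓘(ℝ, E) x).symm z),
    hi.self_comp_inverse]
  rfl

theorem chartField_mlieBracket (X Y : VField E M) (x : M) :
    chartField (VectorField.mlieBracket 𝓘(ℝ, E) X Y) x (extChartAt 𝓘(ℝ, E) x x) =
    VectorField.lieBracket ℝ (chartField X x) (chartField Y x) (extChartAt 𝓘(ℝ, E) x x) := by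
  have hx := mem_extChartAt_source (I := 𝓘(ℝ, E)) x
  have h1 : (mfderivWithin 𝓘(ℝ, E) 𝓘(ℝ, E) (extChartAt 𝓘(ℝ, E) x).symm (Set.range 𝓘(ℝ, E))
      (extChartAt 𝓘(ℝ, E) x x)).inverse = mfderiv 𝓘(ℝ, E) 𝓘(ℝ, E) (extChartAt 𝓘(ℝ, E) x)
        ((extChartAt 𝓘(ℝ, E) x).symm (extChartAt 𝓘(ℝ, E) x x)) :=
    ContinuousLinearMap.inverse_eq
      (mfderivWithin_extChartAt_symm_comp_mfderiv_extChartAt ((extChartAt 𝓘(ℝ, E) x).map_source hx))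
      (mfderiv_extChartAt_comp_mfderivWithin_extChartAt_symm ((extChartAt 𝓘(ℝ, E) x).map_source hx))
  have hi := isInvertible_mfderiv_extChartAt (I := 𝓘(ℝ, E)) hx
  have h2 (v : E) : mfderiv 𝓘(ℝ, E) 𝓘(ℝ, E) (extChartAt 𝓘(ℝ, E) x) x
      ((mfderiv 𝓘(ℝ, E) 𝓘(ℝ, E) (extChartAt 𝓘(ℝ, E) x) x).inverse v) = v :=
    congrArg (fun l ↦ l v) hi.self_comp_inverse
  conv_lhs => rw [chartField]
  rw [VectorField.mpullbackWithin_apply, h1, extChartAt_to_inv,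
    ← VectorField.mlieBracketWithin_univ, VectorField.mlieBracketWithin_apply]
  refine (h2 _).trans ?_
  change VectorField.lieBracketWithin ℝ (chartField X x) (chartField Y x) _ _ = _
  rw [Set.preimage_univ, Set.univ_inter, ModelWithCorners.range_eq_univ,
    VectorField.lieBracketWithin_univ]

theorem differential_mlieBracket {h : M → ℝ} {x : M} (hh : CMDiffAt ∞ h x) {X Y : VField E M}
    (hX : MDiffAt (T% X) x) (hY : MDiffAt (T% Y) x) :
    differential h x (VectorField.mlieBracket 𝓘(ℝ, E) X Y x) =
      differential (fun y ↦ differential h y (Y y)) x (X x) -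
      differential (fun y ↦ differential h y (X y)) x (Y x) := by
  set φ := extChartAt 𝓘(ℝ, E) x with hφ
  have hz : φ x ∈ φ.target := mem_extChartAt_target x
  have hxx : φ.symm (φ x) = x := extChartAt_to_inv x
  have hcd : ContDiffAt ℝ 2 (h ∘ φ.symm) (φ x) := by
    rw [← contMDiffAt_iff_contDiffAt]
    refine ContMDiffAt.comp (φ x) ?_ (((contMDiffOn_extChartAt_symm (n := 2) x) _ hz).contMDiffAt
      ((isOpen_extChartAt_target x).mem_nhds hz))
    rw [hxx]
    exact hh.of_le ENat.LEInfty.out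
  have hev : ∀ᶠ z in 𝓝 (φ x), z ∈ φ.target ∧ MDiffAt h (φ.symm z) := by
    refine Filter.Eventually.and ((isOpen_extChartAt_target x).mem_nhds hz) ?_
    have h1 : ∀ᶠ y in 𝓝 x, CMDiffAt 1 h y := 
      (contMDiffAt_iff_contMDiffAt_nhds (by simp)).1 (hh.of_le ENat.LEInfty.out)
    have h2 : Tendsto φ.symm (𝓝 (φ x)) (𝓝 x) := by
      have := continuousAt_extChartAt_symm (I := 𝓘(ℝ, E)) x
      rw [ContinuousAt, extChartAt_to_inv] at this
      exact this
    exact (h2.eventually h1).mono fun z h ↦ h.mdifferentiableAt (by simp)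
  -- Product rule in the chart: the second-derivative term is symmetric in `U` and `V` and cancels
  -- in the commutator, leaving the bracket of the chart fields.
  have key (U V : VField E M) (hV : MDiffAt (T% V) x) :
      differential (fun y ↦ differential h y (V y)) x (U x) =
        fderiv ℝ (fun z ↦ fderiv ℝ (h ∘ φ.symm) z) (φ x)
          (chartField U x (φ x)) (chartField V x (φ x))
         + fderiv ℝ (h ∘ φ.symm) (φ x) (fderiv ℝ (chartField V x) (φ x) (chartField U x (φ x))) := by
    have hu : MDiffAt (fun y ↦ differential h y (V y)) x :=
      (smoothFormAt_differential hh).mdiffAt.apply hV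
    have h0 := differential_eq_chart hz (h := fun y ↦ differential h y (V y)) (by rwa [hxx]) U
    rw [hxx] at h0
    have heq : (fun y ↦ differential h y (V y)) ∘ φ.symm =ᶠ[𝓝 (φ x)]
        fun z ↦ fderiv ℝ (h ∘ φ.symm) z (chartField V x z) :=
      hev.mono fun z h ↦ differential_eq_chart h.1 h.2 V
    rw [h0, heq.fderiv_eq, fderiv_clm_apply
      ((hcd.fderiv_right (m := 1) (by norm_num)).differentiableAt (by simp))
      (differentiableAt_chartField hV)]
    simp [add_comm]
  have h0 := differential_eq_chart hz (h := h) (X := VectorField.mlieBracket 𝓘(ℝ, E) X Y)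
    hev.self_of_nhds.2
  rw [chartField_mlieBracket, hxx] at h0
  have hsymm : IsSymmSndFDerivAt ℝ (h ∘ φ.symm) (φ x) := hcd.isSymmSndFDerivAt (by simp)
  rw [h0, key X Y hY, key Y X hX, hsymm (chartField X x _), VectorField.lieBracket, map_sub]
  ring

end Smooth

/-! ### Lie derivatives of forms and the Koszul bracket of exact forms -/

section Smooth

variable {E : Type*} [NormedAddCommGroup E] [NormedSpace ℝ E] [FiniteDimensional ℝ E]
  {M : Type*} [TopologicalSpace M] [ChartedSpace E M] [IsManifold 𝓘(ℝ, E) ∞ M]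

theorem differential_add {f g : M → ℝ} {x : M} (hf : MDiffAt f x) (hg : MDiffAt g x) :
    differential (E := E) (f + g) x = differential f x + differential g x := mvfderiv_add hf hg

theorem differential_sub {f g : M → ℝ} {x : M} (hf : MDiffAt f x) (hg : MDiffAt g x) :
    differential (E := E) (f - g) x = differential f x - differential g x := mvfderiv_sub hf hg

theorem differential_neg (f : M → ℝ) (x : M) :
    differential (E := E) (-f) x = -differential f x := mvfderiv_neg

theorem differential_mul {f g : M → ℝ} {x : M} (hf : MDiffAt f x) (hg : MDiffAt g x) :
    differential (E := E) (f * g) x = f x • differential g x + g x • differential f x :=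
  mvfderiv_mul hf hg

theorem lieDerivForm_differential {X : VField E M} {f : M → ℝ} {x : M} (hf : CMDiffAt ∞ f x)
    (hX : MDiffAt (T% X) x) :
    lieDerivForm X (differential f) x = differential (fun y ↦ differential f y (X y)) x := by
  refine formAt_eq _ fun Y hY ↦ ?_
  rw [differential_mlieBracket hf hX hY]
  ring

theorem tensorialAt_lieDerivForm {X : VField E M} {β : OneForm E M} {x : M}
    (hβ : FormMDiffAt β x) :
    TensorialAt 𝓘(ℝ, E) E (fun Y : VField E M ↦ differential (fun y ↦ β y (Y y)) x (X x)
      - β x (VectorField.mlieBracket 𝓘(ℝ, E) X Y x)) x := by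
  have := FiniteDimensional.complete ℝ E
  constructor
  · intro f Y hf hY
    rw [VectorField.mlieBracket_smul_right hf hY]
    have h1 : (fun y ↦ β y ((f • Y) y)) = f * fun y ↦ β y (Y y) := by
      funext y
      simp
    rw [h1, differential_mul hf (hβ.apply hY)]
    simp
    ring
  · intro Y Z hY hZ
    rw [VectorField.mlieBracket_add_right hY hZ]
    have h1 : (fun y ↦ β y ((Y + Z) y)) = (fun y ↦ β y (Y y)) + fun y ↦ β y (Z y) := by
      funext y
      simp
    rw [h1, differential_add (hβ.apply hY) (hβ.apply hZ)]
    simp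
    ring

theorem lieDerivForm_apply {X Y : VField E M} {β : OneForm E M} {x : M}
    (hβ : FormMDiffAt β x) (hY : MDiffAt (T% Y) x) :
    lieDerivForm X β x (Y x) = differential (fun y ↦ β y (Y y)) x (X x)
      - β x (VectorField.mlieBracket 𝓘(ℝ, E) X Y x) :=
  formAt_apply (tensorialAt_lieDerivForm hβ) hY

namespace PoissonTensor

variable (P : PoissonTensor E M)

/-- The Hamiltonian vector field of a function. -/
def ham (f : M → ℝ) : VField E M := P.anchor (differential f)

/-- The Poisson bracket of functions. -/
def bracket (f g : M → ℝ) : M → ℝ := P.pair (differential f) (differential g)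

variable {P}

theorem ham_apply (f : M → ℝ) (x : M) : P.ham f x = P.sharp x (differential f x) := rfl

theorem bracket_eq (f g : M → ℝ) (x : M) : P.bracket f g x = differential g x (P.ham f x) := rfl

theorem pair_antisymm (α β : OneForm E M) : P.pair α β = -P.pair β α := by
  funext x
  exact P.antisymm x (α x) (β x)

theorem bracket_antisymm (f g : M → ℝ) : P.bracket f g = -P.bracket g f := pair_antisymm _ _

theorem contMDiffAt_ham {f : M → ℝ} {x : M} (hf : CMDiffAt ∞ f x) : CMDiffAt ∞ (T% (P.ham f)) x :=
  P.contMDiffAt_anchor (smoothFormAt_differential hf)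

theorem mdiffAt_ham {f : M → ℝ} {x : M} (hf : CMDiffAt ∞ f x) : MDiffAt (T% (P.ham f)) x :=
  (contMDiffAt_ham hf).mdifferentiableAt (by simp)

theorem contMDiffAt_bracket {f g : M → ℝ} {x : M} (hf : CMDiffAt ∞ f x) (hg : CMDiffAt ∞ g x) :
    CMDiffAt ∞ (P.bracket f g) x :=
  (smoothFormAt_differential hg).apply (contMDiffAt_ham hf)

theorem koszulBracket_differential {f g : M → ℝ} {x : M} (hf : CMDiffAt ∞ f x)
    (hg : CMDiffAt ∞ g x) :
    P.koszulBracket (differential f) (differential g) x = differential (P.bracket f g) x := by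
  have h1 : lieDerivForm (P.anchor (differential f)) (differential g) x =
      differential (P.bracket f g) x := lieDerivForm_differential hg (mdiffAt_ham hf)
  have h2 : lieDerivForm (P.anchor (differential g)) (differential f) x =
      differential (P.bracket g f) x := lieDerivForm_differential hf (mdiffAt_ham hg)
  rw [koszulBracket, h1, h2, bracket_antisymm g f, differential_neg]
  change _ - _ - differential (P.bracket f g) x = _
  abel

end PoissonTensor

end Smooth

/-! ### The metric contravariant connection on exact forms -/

section Riemannian

variable {E : Type*} [NormedAddCommGroup E] [NormedSpace ℝ E] [FiniteDimensional ℝ E]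
  {M : Type*} [TopologicalSpace M] [ChartedSpace E M] [IsManifold 𝓘(ℝ, E) ∞ M]
  [RiemannianBundle (fun x : M ↦ TangentSpace 𝓘(ℝ, E) x)]
  [IsContMDiffRiemannianBundle 𝓘(ℝ, E) ∞ E (fun x : M ↦ TangentSpace 𝓘(ℝ, E) x)]

/-- The inner product of the differentials of two functions. -/
def innerDiff (f g : M → ℝ) : M → ℝ := coInner (E := E) (differential f) (differential g)

theorem innerDiff_eq (f g : M → ℝ) (x : M) :
    innerDiff (E := E) f g x = differential (E := E) f x (gradient g x) := coInner_eq _ _ _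

theorem innerDiff_comm (f g : M → ℝ) : innerDiff (E := E) f g = innerDiff (E := E) g f :=
  coInner_comm _ _

theorem contMDiffAt_gradient {f : M → ℝ} {x : M} (hf : CMDiffAt ∞ f x) :
    CMDiffAt ∞ (T% (gradient (E := E) f)) x :=
  (smoothFormAt_differential hf).metricSharp

theorem mdiffAt_gradient {f : M → ℝ} {x : M} (hf : CMDiffAt ∞ f x) :
    MDiffAt (T% (gradient (E := E) f)) x :=
  (contMDiffAt_gradient hf).mdifferentiableAt (by simp)

theorem inner_gradient (f : M → ℝ) (x : M) (v : TangentSpace 𝓘(ℝ, E) x) :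
    inner ℝ (gradient f x) v = differential f x v := inner_metricSharp _ _ _

theorem contMDiffAt_innerDiff {f g : M → ℝ} {x : M} (hf : CMDiffAt ∞ f x) (hg : CMDiffAt ∞ g x) :
    CMDiffAt ∞ (innerDiff (E := E) f g) x := by
  have : innerDiff (E := E) f g = fun x ↦ differential (E := E) f x (gradient g x) :=
    funext (innerDiff_eq f g)
  rw [this]
  exact (smoothFormAt_differential hf).apply (contMDiffAt_gradient hg)

namespace PoissonTensor

variable {P : PoissonTensor E M}

theorem koszulBracket_flat {f : M → ℝ} {Y : VField E M} {x : M} (hf : CMDiffAt ∞ f x)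
    (hY : MDiffAt (T% Y) x) :
    P.koszulBracket (flat Y) (differential f) x = -lieDerivForm (P.ham f) (flat Y) x := by
  have h1 : lieDerivForm (P.anchor (flat Y)) (differential f) x =
      differential (P.pair (flat Y) (differential f)) x :=
    lieDerivForm_differential hf (P.mdiffAt_anchor (formMDiffAt_flat hY))
  rw [koszulBracket, h1]
  change _ - lieDerivForm (P.ham f) (flat Y) x - _ = _
  abel

theorem coInner_koszulBracket_flat {f g : M → ℝ} {Y : VField E M} {x : M} (hf : CMDiffAt ∞ f x)
    (hg : CMDiffAt ∞ g x) (hY : MDiffAt (T% Y) x) :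
    coInner (P.koszulBracket (flat Y) (differential f)) (differential g) x =
      inner ℝ (VectorField.mlieBracket 𝓘(ℝ, E) (P.ham f) (gradient g) x) (Y x)
      - differential (fun y ↦ differential g y (Y y)) x (P.ham f x) := by
  rw [coInner_eq, koszulBracket_flat hf hY]
  change -lieDerivForm (P.ham f) (flat Y) x (gradient g x) = _
  rw [lieDerivForm_apply (formMDiffAt_flat hY) (mdiffAt_gradient hg)]
  have : (fun y ↦ flat Y y (gradient g y)) = fun y ↦ differential g y (Y y) := by
    funext y
    rw [flat_apply, real_inner_comm, inner_gradient]
  rw [this, flat_apply, real_inner_comm]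
  ring

/-- The terms that differentiate `Y` cancel: `π_#(df)` applied to `dg(Y)` occurs once from the
metric and once, with the opposite sign, from `L_{π_#(df)}` of `flat Y`; likewise with `f` and `g`
exchanged. What remains is linear in `Y x`. -/
theorem contravariantKoszul_flat {f g : M → ℝ} {Y : VField E M} {x : M} (hf : CMDiffAt ∞ f x)
    (hg : CMDiffAt ∞ g x) (hY : MDiffAt (T% Y) x) :
    P.contravariantKoszul (differential f) (differential g) (flat Y) x =
      inner ℝ (P.ham (innerDiff (E := E) f g) x
        + VectorField.mlieBracket 𝓘(ℝ, E) (P.ham f) (gradient g) x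
        + VectorField.mlieBracket 𝓘(ℝ, E) (P.ham g) (gradient f) x) (Y x)
      + differential (P.bracket f g) x (Y x) := by
  have h1 (h : M → ℝ) : coInner (E := E) (differential h) (flat Y) =
      fun y ↦ differential (E := E) h y (Y y) := by
    funext y
    rw [coInner_eq, metricSharp_flat]
  have h2 : differential (coInner (E := E) (differential f) (differential g)) x (P.anchor (flat Y) x) =
      -inner ℝ (P.ham (innerDiff (E := E) f g) x) (Y x) := by
    refine (P.antisymm x _ _).trans ?_
    rw [flat_apply, real_inner_comm]
    rfl
  have h3 : coInner (P.koszulBracket (differential f) (differential g)) (flat Y) x =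
      differential (P.bracket f g) x (Y x) := by
    rw [coInner_eq, metricSharp_flat, koszulBracket_differential hf hg]
  rw [contravariantKoszul, coInner_koszulBracket_flat hf hg hY,
    coInner_koszulBracket_flat hg hf hY, h1, h1, h2, h3, inner_add_left, inner_add_left]
  simp only [ham]
  ring

theorem contravariantConnection_differential {f g : M → ℝ} {x : M} (hf : CMDiffAt ∞ f x)
    (hg : CMDiffAt ∞ g x) :
    P.contravariantConnection (differential f) (differential g) x =
      (1 / 2 : ℝ) • (innerSL ℝ (P.ham (innerDiff (E := E) f g) x
        + VectorField.mlieBracket 𝓘(ℝ, E) (P.ham f) (gradient g) x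
        + VectorField.mlieBracket 𝓘(ℝ, E) (P.ham g) (gradient f) x)
      + differential (P.bracket f g) x) := by
  refine formAt_eq _ fun Y hY ↦ ?_
  rw [contravariantKoszul_flat hf hg hY]
  simp [mul_add, inner_add_left]

variable (P) in
/-- The covector `D_{df} dg` at `x`, where `D` is the metric contravariant connection. -/
def conn (f g : M → ℝ) (x : M) : TangentSpace 𝓘(ℝ, E) x →L[ℝ] ℝ :=
  P.contravariantConnection (differential f) (differential g) x

theorem two_mul_conn {f g h : M → ℝ} {x : M} (hf : CMDiffAt ∞ f x)
    (hg : CMDiffAt ∞ g x) (hh : CMDiffAt ∞ h x) :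
    2 * P.conn f g x (gradient (E := E) h x) =
      differential (E := E) (innerDiff (E := E) g h) x (P.ham f x)
      + differential (E := E) (innerDiff (E := E) f h) x (P.ham g x)
      - differential (E := E) (innerDiff (E := E) f g) x (P.ham h x)
      - differential (E := E) (P.bracket f h) x (gradient g x)
      - differential (E := E) (P.bracket g h) x (gradient f x)
      + differential (E := E) (P.bracket f g) x (gradient h x) := by
  have h0 {f g : M → ℝ} (hf : CMDiffAt ∞ f x) (hg : CMDiffAt ∞ g x) :
      inner ℝ (VectorField.mlieBracket 𝓘(ℝ, E) (P.ham f) (gradient g) x) (gradient h x) =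
        differential (E := E) (innerDiff (E := E) g h) x (P.ham f x)
        - differential (E := E) (P.bracket f h) x (gradient g x) := by
    rw [real_inner_comm, inner_gradient, differential_mlieBracket hh (mdiffAt_ham hf)
      (mdiffAt_gradient hg), innerDiff_comm, funext (innerDiff_eq h g)]
    rfl
  have h1 : inner ℝ (P.ham (innerDiff (E := E) f g) x) (gradient h x) =
      -differential (innerDiff (E := E) f g) x (P.ham h x) := by
    rw [real_inner_comm, inner_gradient]
    exact P.antisymm x _ _
  rw [conn, contravariantConnection_differential hf hg]
  simp only [smul_apply, add_apply, innerSL_apply_apply,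
    inner_add_left, h0 hf hg, h0 hg hf, h1, smul_eq_mul]
  ring

/-- Vanishing torsion, since the Koszul bracket of `df` and `dg` is `d{f,g}`. -/
theorem conn_sub_conn {f g : M → ℝ} {x : M} (hf : CMDiffAt ∞ f x) (hg : CMDiffAt ∞ g x) :
    P.conn f g x - P.conn g f x = differential (P.bracket f g) x := by
  rw [conn, conn, contravariantConnection_differential hf hg,
    contravariantConnection_differential hg hf, innerDiff_comm g f, bracket_antisymm g f]
  rw [differential_neg, add_right_comm (P.ham (innerDiff f g) x)]
  module

/-- Compatibility of `D` with the metric; its right-hand side vanishes when `π_#(df) = 0` at `x`,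
and `D_{df}` is then skew-adjoint. -/
theorem conn_add_conn {f g h : M → ℝ} {x : M} (hf : CMDiffAt ∞ f x)
    (hg : CMDiffAt ∞ g x) (hh : CMDiffAt ∞ h x) :
    P.conn f g x (gradient (E := E) h x) + P.conn f h x (gradient g x) =
      differential (innerDiff (E := E) g h) x (P.ham f x) := by
  have h1 := two_mul_conn (P := P) hf hg hh
  have h2 := two_mul_conn (P := P) hf hh hg
  rw [innerDiff_comm h g, bracket_antisymm h g] at h2
  rw [differential_neg, neg_apply] at h2
  linarith

end PoissonTensor

end Riemannian

/-! ### Global functions with prescribed germ or differential -/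

section Smooth

variable {E : Type*} [NormedAddCommGroup E] [NormedSpace ℝ E] [FiniteDimensional ℝ E]
  {M : Type*} [TopologicalSpace M] [ChartedSpace E M] [IsManifold 𝓘(ℝ, E) ∞ M]

theorem exists_contMDiff_eventuallyEq [T2Space M] {f : M → ℝ} {U : Set M} (hU : IsOpen U) {x : M}
    (hx : x ∈ U) (hf : CMDiff[U] ∞ f) : ∃ F : M → ℝ, CMDiff ∞ F ∧ F =ᶠ[𝓝 x] f := by
  obtain ⟨φ, -, hφ⟩ := ((SmoothBumpFunction.nhds_basis_tsupport (I := 𝓘(ℝ, E)) x).mem_iff).1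
    (hU.mem_nhds hx)
  refine ⟨fun y ↦ φ y * f y, contMDiff_of_tsupport fun y hy ↦ ?_, ?_⟩
  · have hyU : y ∈ U := hφ (closure_mono (Function.support_mul_subset_left _ _) hy)
    exact φ.contMDiffAt.mul ((hf y hyU).contMDiffAt (hU.mem_nhds hyU))
  · filter_upwards [φ.eventuallyEq_one] with y hy
    simp [hy]

theorem exists_contMDiff_differential_eq [T2Space M] {x : M}
    (a : TangentSpace 𝓘(ℝ, E) x →L[ℝ] ℝ) :
    ∃ f : M → ℝ, CMDiff ∞ f ∧ differential f x = a := by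
  have hi := isInvertible_mfderiv_extChartAt (I := 𝓘(ℝ, E)) (mem_extChartAt_source (I := 𝓘(ℝ, E)) x)
  set A := mfderiv 𝓘(ℝ, E) 𝓘(ℝ, E) (extChartAt 𝓘(ℝ, E) x) x with hA
  -- The function is linear in the chart at `x`, with the covector transported by the derivative of
  -- the chart, then cut off by a bump function.
  let l : E →L[ℝ] ℝ := a ∘L A.inverse
  have hl : CMDiff[(chartAt E x).source] ∞ (fun y ↦ l (extChartAt 𝓘(ℝ, E) x y)) :=
    l.contMDiff.comp_contMDiffOn contMDiffOn_extChartAt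
  obtain ⟨F, hF, hFe⟩ := exists_contMDiff_eventuallyEq (chartAt E x).open_source
    (mem_chart_source E x) hl
  refine ⟨F, hF, ?_⟩
  have h1 : mfderiv 𝓘(ℝ, E) 𝓘(ℝ, ℝ) F x = mfderiv 𝓘(ℝ, E) 𝓘(ℝ, ℝ) (l ∘ extChartAt 𝓘(ℝ, E) x) x :=
    hFe.mfderiv_eq
  have h2 : mfderiv 𝓘(ℝ, E) 𝓘(ℝ, ℝ) (l ∘ extChartAt 𝓘(ℝ, E) x) x = l ∘L A := by
    rw [mfderiv_comp x l.mdifferentiableAt (mdifferentiableAt_extChartAt (mem_chart_source E x)),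
      l.mfderiv_eq]
    rfl
  ext v
  have h3 : A.inverse (A v) = v := congrArg (fun l ↦ l v) hi.inverse_comp_self
  have h4 : differential F x v = l (A v) := congrArg (fun l ↦ l v) (h1.trans h2)
  rw [h4]
  exact congrArg a h3

theorem differential_congr {f g : M → ℝ} {x : M} (h : f =ᶠ[𝓝 x] g) :
    differential (E := E) f x = differential g x := by
  have := h.mfderiv_eq (I := 𝓘(ℝ, E)) (I' := 𝓘(ℝ, ℝ))
  ext v
  exact congrArg (fun l ↦ l v) this

namespace PoissonTensor

variable {P : PoissonTensor E M}

theorem jacobi_bracket {f g h : M → ℝ} (hf : CMDiff ∞ f) (hg : CMDiff ∞ g) (hh : CMDiff ∞ h)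
    (x : M) : differential (P.bracket g h) x (P.ham f x) + differential (P.bracket h f) x (P.ham g x)
      + differential (P.bracket f g) x (P.ham h x) = 0 :=
  P.jacobi f g h hf hg hh x

theorem sharp_eq_zero [T2Space M] {x : M} {a : TangentSpace 𝓘(ℝ, E) x →L[ℝ] ℝ}
    (h : ∀ f : M → ℝ, CMDiff ∞ f → a (P.ham f x) = 0) : P.sharp x a = 0 := by
  have : T2Space (TangentSpace 𝓘(ℝ, E) x) := inferInstanceAs (T2Space E)
  by_contra hne
  obtain ⟨b, hb⟩ : ∃ b : Module.Dual ℝ (TangentSpace 𝓘(ℝ, E) x), b (P.sharp x a) ≠ 0 := by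
    by_contra! hb
    exact hne ((Module.forall_dual_apply_eq_zero_iff ℝ _).1 hb)
  obtain ⟨f, hf, hfb⟩ := exists_contMDiff_differential_eq (LinearMap.toContinuousLinearMap b)
  apply hb
  have := h f hf
  rw [ham_apply, hfb, P.antisymm] at this
  simpa using this

variable (P) in
/-- The isotropy Lie algebra `ker π_#` at `x` is abelian. This holds wherever the rank of `π` is
locally constant. -/
def AbelianIsotropy (x : M) : Prop :=
  ∀ f g : M → ℝ, CMDiff ∞ f → CMDiff ∞ g → P.ham f x = 0 → P.ham g x = 0 →
    differential (E := E) (P.bracket f g) x = 0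

end PoissonTensor
end Smooth

/-! ### Vanishing of `D_α` for `α` in the kernel of the anchor -/

section Riemannian

variable {E : Type*} [NormedAddCommGroup E] [NormedSpace ℝ E] [FiniteDimensional ℝ E]
  {M : Type*} [TopologicalSpace M] [ChartedSpace E M] [IsManifold 𝓘(ℝ, E) ∞ M]
  [RiemannianBundle (fun x : M ↦ TangentSpace 𝓘(ℝ, E) x)]
  [IsContMDiffRiemannianBundle 𝓘(ℝ, E) ∞ E (fun x : M ↦ TangentSpace 𝓘(ℝ, E) x)]

namespace PoissonTensor

variable {P : PoissonTensor E M}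

theorem IsParallel.conn_ham (hP : P.IsParallel) {f g h : M → ℝ} (hf : CMDiff ∞ f)
    (hg : CMDiff ∞ g) (hh : CMDiff ∞ h) (x : M) :
    P.conn f h x (P.ham g x) - P.conn f g x (P.ham h x) =
      differential (P.bracket g h) x (P.ham f x) := by
  have hs {f : M → ℝ} (hf : CMDiff ∞ f) : SmoothFormOn (differential (E := E) f) Set.univ :=
    fun x _ ↦ (smoothFormAt_differential (hf x)).contMDiffWithinAt
  have h0 := hP (differential f) (differential g) (differential h) (hs hf) (hs hg) (hs hh) x
  have h1 : P.pair (P.contravariantConnection (differential f) (differential g)) (differential h) x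
    = -P.conn f g x (P.ham h x) := P.antisymm x _ _
  have h2 : P.pair (differential g) (P.contravariantConnection (differential f) (differential h)) x
    = P.conn f h x (P.ham g x) := rfl
  have h3 : differential (P.pair (differential g) (differential h)) x (P.anchor (differential f) x)
    = differential (P.bracket g h) x (P.ham f x) := rfl
  rw [h1, h2, h3] at h0
  linarith

theorem IsParallel.conn_eq_zero [T2Space M] (hP : P.IsParallel) {x : M} (hx : P.AbelianIsotropy x)
    {k g : M → ℝ} (hk : CMDiff ∞ k) (hg : CMDiff ∞ g) (hkx : P.ham k x = 0) :
    P.conn k g x = 0 := by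
  -- Parallelism gives `(D_{dg} dk)(π_# dh)`, vanishing torsion exchanges `g` and `k`, and the
  -- Jacobi identity cancels the rest. Hence `D_{dk} dg` lies in `ker π_#`, by antisymmetry of `π`.
  have ham_conn {g h : M → ℝ} (hg : CMDiff ∞ g) (hh : CMDiff ∞ h) :
      P.conn k g x (P.ham h x) = 0 := by
    have h1 := hP.conn_ham hg hk hh x
    have h2 := congrArg (fun l ↦ l (P.ham h x)) (conn_sub_conn (P := P) (hk x) (hg x))
    have h3 := P.jacobi_bracket hg hk hh x
    rw [bracket_antisymm g k, differential_neg] at h3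
    simp only [hkx, map_zero, sub_apply, neg_apply] at h1 h2 h3
    linarith
  have skew {g h : M → ℝ} (hg : CMDiff ∞ g) (hh : CMDiff ∞ h) :
      P.conn k g x (gradient h x) + P.conn k h x (gradient g x) = 0 := by
    rw [conn_add_conn (hk x) (hg x) (hh x), hkx, map_zero]
  have exists_rep {g : M → ℝ} (hg : CMDiff ∞ g) : ∃ d : M → ℝ, CMDiff ∞ d ∧
      differential d x = P.conn k g x ∧ P.ham d x = 0 := by
    obtain ⟨d, hd, hdx⟩ := exists_contMDiff_differential_eq (P.conn k g x)
    refine ⟨d, hd, hdx, ?_⟩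
    rw [ham_apply, hdx]
    exact sharp_eq_zero fun h hh ↦ ham_conn hg hh
  have eq_zero {d : M → ℝ} (h : differential d x (gradient (E := E) d x) = 0) :
      differential (E := E) d x = 0 := by
    rw [← inner_gradient] at h
    ext v
    rw [← inner_gradient, inner_self_eq_zero.1 h, inner_zero_left]
    rfl
  -- With `dd = D_{dk} dc` at `x`, again in `ker π_#`, the Koszul formula for `k`, `c`, `d` has only
  -- zero terms, so `|dd|² = 0`.
  have on_ker {c : M → ℝ} (hc : CMDiff ∞ c) (hcx : P.ham c x = 0) : P.conn k c x = 0 := by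
    obtain ⟨d, hd, hdx, hdk⟩ := exists_rep hc
    rw [← hdx]
    apply eq_zero
    have := two_mul_conn (P := P) (hk x) (hc x) (hd x)
    simp only [hkx, hcx, hdk, map_zero, hx _ _ hk hd hkx hdk, hx _ _ hc hd hcx hdk,
      hx _ _ hk hc hkx hcx, zero_apply] at this
    rw [hdx]
    linarith
  -- Now `dd = D_{dk} dg`, and skewness gives `|dd|² = -⟨dg, D_{dk} dd⟩`, which is zero because `dd`
  -- is in the kernel.
  obtain ⟨d, hd, hdx, hdk⟩ := exists_rep hg
  rw [← hdx]
  apply eq_zero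
  have := skew hg hd
  rwa [on_ker hd hdk, zero_apply, add_zero, ← hdx] at this

end PoissonTensor
end Riemannian

/-! ### Kernels of constant rank, and brackets of functions at regular points -/

/-- If the rank of a continuous family of endomorphisms is locally maximal at `x`, where the
endomorphism is skew-adjoint, then every element of the kernel at `x` extends to a continuous family
of elements of the kernels. -/
theorem exists_continuousAt_ker {X V : Type*} [TopologicalSpace X] [NormedAddCommGroup V]
    [InnerProductSpace ℝ V] [FiniteDimensional ℝ V] {J : X → V →L[ℝ] V} {x : X}
    (hJ : ContinuousAt J x) (hskew : ∀ v w, inner ℝ (J x v) w = -inner ℝ v (J x w))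
    (hrank : ∀ᶠ z in 𝓝 x, Module.finrank ℝ (J x).ker ≤ Module.finrank ℝ (J z).ker)
    {v : V} (hv : J x v = 0) :
    ∃ u : X → V, ContinuousAt u x ∧ u x = v ∧ ∀ᶠ z in 𝓝 x, J z (u z) = 0 := by
  have := FiniteDimensional.complete ℝ V
  set K : Submodule ℝ V := (J x).ker with hK
  let q : V →L[ℝ] V := K.starProjection
  have hqK (w : V) : J x (q w) = 0 := (K.starProjection_apply_mem w : q w ∈ K)
  have hq_of (w : V) (hw : J x w = 0) : q w = w := K.starProjection_eq_self_iff.2 hw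
  -- The range of a skew-adjoint map is orthogonal to its kernel.
  have hqJ (w : V) : q (J x w) = 0 := by
    refine (K.starProjection_apply_eq_zero_iff).2 fun k hk ↦ ?_
    rw [real_inner_comm, hskew, show J x k = 0 from hk, inner_zero_right, neg_zero]
  -- `N z = (1 - q) J z + q` is invertible at `x`, hence nearby. Solving `N z u = v` gives a
  -- continuous `u` with `q u = v` and `(1 - q) J z u = 0`.
  let N (z : X) : V →L[ℝ] V := J z - q ∘L J z + q
  have hN (z : X) (w : V) : N z w = J z w - q (J z w) + q w := rfl
  have hqN (z : X) (w : V) : q (N z w) = q w := by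
    rw [hN, map_add, map_sub, hq_of (q (J z w)) (hqK _), hq_of (q w) (hqK _)]
    abel
  have hinj : Function.Injective (N x).toLinearMap := by
    rw [← LinearMap.ker_eq_bot, LinearMap.ker_eq_bot']
    intro w hw
    have hw : N x w = 0 := hw
    have h1 : q w = 0 := by rw [← hqN x, hw, map_zero]
    rw [hN, hqJ, h1, add_zero, sub_zero] at hw
    rw [← hq_of w hw, h1]
  let e : V ≃L[ℝ] V := (LinearEquiv.ofInjectiveEndo _ hinj).toContinuousLinearEquiv
  have he : (e : V →L[ℝ] V) = N x := by ext; rfl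
  have hNc : ContinuousAt N x := (hJ.sub (continuousAt_const.clm_comp hJ)).add continuousAt_const
  have hinv : ∀ᶠ z in 𝓝 x, N z ∈ Set.range ((↑) : (V ≃L[ℝ] V) → V →L[ℝ] V) :=
    hNc.eventually (by rw [← he]; exact ContinuousLinearEquiv.nhds e)
  have hic : ContinuousAt (fun z ↦ (N z).inverse) x := by
    refine ContinuousAt.comp (g := ContinuousLinearMap.inverse) ?_ hNc
    rw [← he]
    exact (contDiffAt_map_inverse (n := 0) e).continuousAt
  refine ⟨fun z ↦ (N z).inverse v, hic.clm_apply continuousAt_const, ?_, ?_⟩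
  · have h1 : N x v = v := by rw [hN, hv, hq_of v hv, map_zero, sub_zero, zero_add]
    change (N x).inverse v = v
    rw [← he, ContinuousLinearMap.inverse_equiv]
    exact e.symm_apply_eq.2 h1.symm
  · filter_upwards [hinv, hrank] with z ⟨f, hf⟩ hz
    have hNv : N z ((N z).inverse v) = v := by
      rw [← hf, ContinuousLinearMap.inverse_equiv]
      exact f.apply_symm_apply v
    set w := (N z).inverse v with hw
    have hqv : q v = v := hq_of v hv
    let L : V →ₗ[ℝ] V := (J z - q ∘L J z).toLinearMap
    have hLw : L w = 0 := by
      have h2 : q w = v := by rw [← hqN z, hNv, hqv]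
      have h3 := hN z w
      rw [hNv, h2] at h3
      exact left_eq_add.1 (h3.trans (add_comm _ _))
    have hle : (J z).ker ≤ LinearMap.ker L := fun y hy ↦ by
      have hy : J z y = 0 := hy
      change J z y - q (J z y) = 0
      rw [hy, map_zero, sub_zero]
    -- `N z` coincides with `q` on `ker L`, so it embeds `ker L` in `K`. The rank hypothesis then
    -- squeezes `ker (J z) ≤ ker L` to an equality, so the `(1 - q)` may be dropped.
    have hfin : Module.finrank ℝ (LinearMap.ker L) ≤ Module.finrank ℝ K := by
      let g : LinearMap.ker L →ₗ[ℝ] K := LinearMap.codRestrict K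
        ((N z).toLinearMap ∘ₗ (LinearMap.ker L).subtype) fun y ↦ by
          have hy : J z y - q (J z y) = 0 := y.2
          change J x (J z y - q (J z y) + q y) = 0
          rw [hy, zero_add, hqK]
      refine LinearMap.finrank_le_finrank_of_injective (f := g) fun y y' hyy ↦ ?_
      have h4 : f (y : V) = f (y' : V) := by
        have := congrArg Subtype.val hyy
        have h5 : N z y = N z y' := this
        rwa [← hf] at h5
      exact Subtype.ext (f.injective h4)
    have heq := Submodule.eq_of_le_of_finrank_le hle (hfin.trans hz)
    have : w ∈ (J z).ker := by
      rw [heq]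
      exact hLw
    exact this

section Smooth

variable {E : Type*} [NormedAddCommGroup E] [NormedSpace ℝ E] [FiniteDimensional ℝ E]
  {M : Type*} [TopologicalSpace M] [ChartedSpace E M] [IsManifold 𝓘(ℝ, E) ∞ M]

/-- A product of two functions vanishing at `x`, one differentiable and the other one continuous,
has vanishing derivative at `x`. -/
theorem hasMFDerivAt_mul_zero {p q : M → ℝ} {x : M} (hp : MDiffAt p x) (hpx : p x = 0)
    (hq : ContinuousAt q x) (hqx : q x = 0) :
    HasMFDerivAt 𝓘(ℝ, E) 𝓘(ℝ, ℝ) (fun y ↦ p y * q y) x 0 := by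
  set φ := extChartAt 𝓘(ℝ, E) x
  have hxx : φ.symm (φ x) = x := extChartAt_to_inv x
  have hd : DifferentiableAt ℝ (p ∘ φ.symm) (φ x) := by
    rw [← mdifferentiableAt_iff_differentiableAt]
    refine MDifferentiableAt.comp (φ x) (by rwa [hxx]) ?_
    exact ((contMDiffOn_extChartAt_symm (n := 1) x) _ (mem_extChartAt_target x)).contMDiffAt
      ((isOpen_extChartAt_target x).mem_nhds (mem_extChartAt_target x)) |>.mdifferentiableAt
      (by simp)
  have h1 : (p ∘ φ.symm) =O[𝓝 (φ x)] fun z ↦ z - φ x := by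
    have := hd.hasFDerivAt.isBigO_sub
    simpa [hxx, hpx, Function.comp_def] using this
  have h2 : (q ∘ φ.symm) =o[𝓝 (φ x)] fun _ ↦ (1 : ℝ) := by
    rw [Asymptotics.isLittleO_one_iff, ← hqx]
    have : Tendsto φ.symm (𝓝 (φ x)) (𝓝 x) := by
      have := continuousAt_extChartAt_symm (I := 𝓘(ℝ, E)) x
      rw [ContinuousAt, extChartAt_to_inv] at this
      exact this
    exact hq.tendsto.comp this
  have h3 : HasFDerivAt (fun z ↦ p (φ.symm z) * q (φ.symm z)) (0 : E →L[ℝ] ℝ) (φ x) := by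
    rw [hasFDerivAt_iff_isLittleO]
    have h4 := h1.norm_right.mul_isLittleO h2
    simp only [mul_one] at h4
    simpa [hxx, hpx] using h4
  have h5 := h3.hasMFDerivAt.comp x
    (mdifferentiableAt_extChartAt (I := 𝓘(ℝ, E)) (mem_chart_source E x)).hasMFDerivAt
  have h6 : (fun y ↦ p y * q y) =ᶠ[𝓝 x] (fun z ↦ p (φ.symm z) * q (φ.symm z)) ∘ φ := by
    filter_upwards [extChartAt_source_mem_nhds (I := 𝓘(ℝ, E)) x] with y hy
    simp [φ.left_inv hy]
  refine (h5.congr_of_eventuallyEq h6).congr_mfderiv ?_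
  exact ContinuousLinearMap.zero_comp _

end Smooth

section Smooth

variable {E : Type*} [NormedAddCommGroup E] [NormedSpace ℝ E] [FiniteDimensional ℝ E]
  {M : Type*} [TopologicalSpace M] [ChartedSpace E M] [IsManifold 𝓘(ℝ, E) ∞ M]

theorem finrank_tangentSpace_dual (x : M) :
    Module.finrank ℝ (TangentSpace 𝓘(ℝ, E) x →L[ℝ] ℝ) = Module.finrank ℝ E := by
  change Module.finrank ℝ (E →L[ℝ] ℝ) = Module.finrank ℝ E
  rw [← LinearEquiv.finrank_eq (LinearMap.toContinuousLinearMap (𝕜 := ℝ) (E := E) (F' := ℝ))]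
  exact Subspace.dual_finrank_eq

theorem differential_sum {ι : Type*} (s : Finset ι) {f : ι → M → ℝ} {x : M}
    (hf : ∀ i, MDiffAt (f i) x) : MDiffAt (∑ i ∈ s, f i) x ∧
      differential (E := E) (∑ i ∈ s, f i) x = ∑ i ∈ s, differential (f i) x := by
  classical
  induction s using Finset.induction_on with
  | empty => exact ⟨mdifferentiableAt_const, mvfderiv_zero⟩
  | insert a s ha ih =>
    rw [Finset.sum_insert ha, Finset.sum_insert ha, ← ih.2]
    exact ⟨(hf a).add ih.1, differential_add (hf a) ih.1⟩

/-- The linear combination of the functions `f i` with coefficients `c i`. -/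
def comb {ι : Type*} [Fintype ι] (f : ι → M → ℝ) (c : ι → ℝ) : M → ℝ := ∑ i, fun x ↦ c i * f i x

section comb

variable {ι : Type*} [Fintype ι] {f : ι → M → ℝ}

theorem contMDiff_comb (hf : ∀ i, CMDiff ∞ (f i)) (c : ι → ℝ) : CMDiff ∞ (comb f c) := by
  have : comb f c = fun x ↦ ∑ i, c i * f i x := by
    funext x
    simp [comb]
  rw [this]
  exact contMDiff_finsetSum fun i _ ↦ contMDiff_const.mul (hf i)

theorem differential_comb {x : M} (hf : ∀ i, MDiffAt (f i) x) (c : ι → ℝ) :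
    differential (E := E) (comb f c) x = ∑ i, c i • differential (f i) x := by
  have h1 (i : ι) : MDiffAt (fun _ : M ↦ c i) x := mdifferentiableAt_const
  refine (differential_sum (f := fun i x ↦ c i * f i x) Finset.univ
    fun i ↦ (h1 i).mul (hf i)).2.trans ?_
  refine Finset.sum_congr rfl fun i _ ↦ (differential_mul (h1 i) (hf i)).trans ?_
  rw [show differential (E := E) (fun _ : M ↦ c i) x = 0 from mvfderiv_const _]
  simp

namespace PoissonTensor

variable {P : PoissonTensor E M}

theorem ham_comb {x : M} (hf : ∀ i, MDiffAt (f i) x) (c : ι → ℝ) :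
    P.ham (comb f c) x = ∑ i, c i • P.ham (f i) x := by
  simp [ham_apply, differential_comb hf]

theorem bracket_comb_right (hf : ∀ i, MDiff (f i)) (c : ι → ℝ) (g : M → ℝ) (x : M) :
    P.bracket g (comb f c) x = ∑ i, c i * P.bracket g (f i) x := by
  simp [bracket_eq, differential_comb (fun i ↦ hf i x)]

theorem bracket_comb_left (hf : ∀ i, MDiff (f i)) (c : ι → ℝ) (g : M → ℝ) (x : M) :
    P.bracket (comb f c) g x = ∑ i, c i * P.bracket (f i) g x := by
  simp [bracket_eq, ham_comb (fun i ↦ hf i x)]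

variable (P) in
/-- The matrix of the bivector field with respect to the differentials of the functions `f i`. -/
def bracketMatrix (f : ι → M → ℝ) (x : M) : Matrix ι ι ℝ := .of fun i j ↦ P.bracket (f i) (f j) x

end PoissonTensor

variable (E) in
/-- The differentials of the functions `f i` form a basis of the cotangent space at `x`. -/
def IsCoframeAt (f : ι → M → ℝ) (x : M) : Prop :=
  LinearIndependent ℝ (fun i ↦ differential (E := E) (f i) x) ∧
    Fintype.card ι = Module.finrank ℝ E

/-- The basis of the cotangent space consisting of the differentials of the functions `f i`. -/
def IsCoframeAt.basis {x : M} (h : IsCoframeAt E f x) :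
    Module.Basis ι ℝ (TangentSpace 𝓘(ℝ, E) x →L[ℝ] ℝ) :=
  Module.Basis.mk h.1 (h.1.span_eq_top_of_card_eq_finrank'
    (h.2.trans (finrank_tangentSpace_dual x).symm)).ge

theorem IsCoframeAt.basis_apply {x : M} (h : IsCoframeAt E f x) (i : ι) :
    h.basis i = differential (f i) x := by
  simp [basis]

theorem IsCoframeAt.exists_comb {x : M} (h : IsCoframeAt E f x) (hf : ∀ i, MDiffAt (f i) x)
    (a : TangentSpace 𝓘(ℝ, E) x →L[ℝ] ℝ) : ∃ c : ι → ℝ, differential (comb f c) x = a := by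
  refine ⟨h.basis.repr a, ?_⟩
  rw [differential_comb hf]
  conv_rhs => rw [← h.basis.sum_repr a]
  simp only [h.basis_apply]

theorem IsCoframeAt.eq_zero {x : M} (h : IsCoframeAt E f x) {v : TangentSpace 𝓘(ℝ, E) x}
    (hv : ∀ i, differential (f i) x v = 0) : v = 0 := by
  have : T2Space (TangentSpace 𝓘(ℝ, E) x) := inferInstanceAs (T2Space E)
  refine (Module.forall_dual_apply_eq_zero_iff ℝ v).1 fun b ↦ ?_
  have h1 := h.basis.sum_repr (LinearMap.toContinuousLinearMap b)
  have h2 := congrArg (fun l ↦ l v) h1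
  simp only [h.basis_apply, sum_apply, smul_apply, hv, smul_zero, Finset.sum_const_zero] at h2
  exact h2.symm

namespace PoissonTensor

variable {P : PoissonTensor E M} [DecidableEq ι]

theorem bracketMatrix_apply (hf : ∀ i, MDiff (f i)) (x : M) (w : EuclideanSpace ℝ ι) :
    Matrix.toEuclideanCLM (𝕜 := ℝ) (P.bracketMatrix f x) w =
      WithLp.toLp 2 fun i ↦ P.bracket (f i) (comb f w) x := by
  ext i
  change _ = P.bracket (f i) (comb f w) x
  rw [bracket_comb_right hf]
  simp [Matrix.ofLp_toEuclideanCLM, Matrix.mulVec, dotProduct, bracketMatrix, mul_comm]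

/-- In a coframe of exact forms the anchor becomes a matrix acting on a fixed Euclidean space, to
which `exists_continuousAt_ker` applies. -/
theorem finrank_ker_bracketMatrix {x : M} (h : IsCoframeAt E f x) (hf : ∀ i, MDiff (f i)) :
    Module.finrank ℝ (Matrix.toEuclideanCLM (𝕜 := ℝ) (P.bracketMatrix f x)).ker =
      Module.finrank ℝ (P.sharp x).ker := by
  let e : EuclideanSpace ℝ ι ≃ₗ[ℝ] (TangentSpace 𝓘(ℝ, E) x →L[ℝ] ℝ) :=
    (WithLp.linearEquiv 2 ℝ (ι → ℝ)).trans h.basis.equivFun.symm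
  have he (w : EuclideanSpace ℝ ι) : e w = differential (comb f w) x := by
    rw [differential_comb fun i ↦ hf i x]
    simp [e, Module.Basis.equivFun_symm_apply, h.basis_apply]
  have hker : (Matrix.toEuclideanCLM (𝕜 := ℝ) (P.bracketMatrix f x)).ker =
      (P.sharp x).ker.comap e.toLinearMap := by
    ext w
    change Matrix.toEuclideanCLM (𝕜 := ℝ) (P.bracketMatrix f x) w = 0 ↔ P.sharp x (e w) = 0
    rw [he, bracketMatrix_apply hf]
    refine ⟨fun hw ↦ h.eq_zero fun i ↦ ?_, fun hw ↦ ?_⟩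
    · have := congrArg (fun u ↦ u i) hw
      simp only [bracket_antisymm (f i)] at this
      exact neg_eq_zero.1 this
    · ext i
      change P.bracket (f i) (comb f w) x = 0
      rw [bracket_antisymm]
      change -differential (f i) x (P.sharp x (differential (comb f w) x)) = 0
      rw [hw, map_zero, neg_zero]
  rw [hker]
  exact LinearEquiv.finrank_eq (e.ofSubmodule' _)

variable (P) in
/-- The rank of the bivector field is locally maximal at `x`. -/
def IsRegularAt (x : M) : Prop :=
  ∀ᶠ z in 𝓝 x, Module.finrank ℝ (P.sharp x).ker ≤ Module.finrank ℝ (P.sharp z).ker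

theorem differential_bracket_comb (hf : ∀ i, CMDiff ∞ (f i)) {x : M} (hx : P.IsRegularAt x)
    (hfx : ∀ᶠ z in 𝓝 x, IsCoframeAt E f z) {c d : ι → ℝ} (hc : P.ham (comb f c) x = 0)
    (hd : P.ham (comb f d) x = 0) :
    differential (E := E) (P.bracket (comb f c) (comb f d)) x = 0 := by
  have hfd (i : ι) : MDiff (f i) := (hf i).mdifferentiable (by simp)
  let J (z : M) := Matrix.toEuclideanCLM (𝕜 := ℝ) (P.bracketMatrix f z)
  have hJ : ContinuousAt J x := by
    refine ContinuousAt.comp (g := Matrix.toEuclideanCLM (n := ι) (𝕜 := ℝ)) ?_ ?_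
    · exact (LinearMap.continuous_of_finiteDimensional
        (Matrix.toEuclideanCLM (n := ι) (𝕜 := ℝ)).toAlgEquiv.toLinearMap).continuousAt
    · exact continuousAt_pi.2 fun i ↦ continuousAt_pi.2 fun j ↦
        (contMDiffAt_bracket (hf i x) (hf j x)).continuousAt
  have hskew (v w : EuclideanSpace ℝ ι) : inner ℝ (J x v) w = -inner ℝ v (J x w) := by
    have h1 (i j : ι) : P.bracketMatrix f x j i = -P.bracketMatrix f x i j :=
      congrFun (bracket_antisymm (f j) (f i)) x
    have h2 : (P.bracketMatrix f x).transpose = -P.bracketMatrix f x := by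
      ext i j
      exact h1 i j
    rw [real_inner_comm, Matrix.inner_toEuclideanCLM, Matrix.inner_toEuclideanCLM]
    rw [Matrix.dotProduct_mulVec, ← Matrix.mulVec_transpose, h2, Matrix.neg_mulVec, neg_dotProduct,
      dotProduct_comm]
  have hrank : ∀ᶠ z in 𝓝 x, Module.finrank ℝ (J x).ker ≤ Module.finrank ℝ (J z).ker := by
    filter_upwards [hx, hfx] with z hz hfz
    rwa [finrank_ker_bracketMatrix hfz hfd, finrank_ker_bracketMatrix hfx.self_of_nhds hfd]
  have hker (c : ι → ℝ) (hc : P.ham (comb f c) x = 0) (i : ι) : P.bracket (f i) (comb f c) x = 0 := by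
    rw [bracket_antisymm]
    change -differential (f i) x (P.ham (comb f c) x) = 0
    rw [hc, map_zero, neg_zero]
  obtain ⟨u, hu, hux, huJ⟩ := exists_continuousAt_ker hJ hskew hrank (v := WithLp.toLp 2 d) (by
    rw [bracketMatrix_apply hfd]
    ext i
    exact hker d hd i)
  -- The vector `u z` lies in the kernel of the matrix at `z`, so adding `∑ u_i {f_i, comb f c} = 0`
  -- changes nothing. Every summand is then a product of two factors vanishing at `x`, and mere
  -- continuity of `u` is enough to kill its derivative.
  have hev : P.bracket (comb f c) (comb f d) =ᶠ[𝓝 x]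
      ∑ i, fun z ↦ P.bracket (f i) (comb f c) z * (u z i - d i) := by
    filter_upwards [huJ] with z hz
    rw [bracketMatrix_apply hfd] at hz
    have h1 (i : ι) : P.bracket (f i) (comb f (u z)) z = 0 := congrArg (fun w ↦ w i) hz
    have h2 : ∑ i, u z i * P.bracket (f i) (comb f c) z = 0 := by
      rw [← bracket_comb_left hfd, bracket_antisymm]
      change -P.bracket (comb f c) (comb f (u z)) z = 0
      rw [bracket_comb_left hfd]
      simp [h1]
    have h3 : P.bracket (comb f c) (comb f d) z = -∑ i, d i * P.bracket (f i) (comb f c) z := by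
      rw [← bracket_comb_left hfd, bracket_antisymm]
      rfl
    rw [h3, Finset.sum_apply, ← zero_sub, ← h2, ← Finset.sum_sub_distrib]
    exact Finset.sum_congr rfl fun i _ ↦ by ring
  have hz (i : ι) := hasMFDerivAt_mul_zero (p := P.bracket (f i) (comb f c))
    (q := fun z ↦ u z i - d i) (x := x)
    ((contMDiffAt_bracket (hf i x) (contMDiff_comb hf c x)).mdifferentiableAt (by simp))
    (hker c hc i)
    ((((EuclideanSpace.proj (𝕜 := ℝ) i).continuous.continuousAt).comp hu).sub continuousAt_const)
    (by simp [hux])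
  rw [differential_congr hev, (differential_sum _ fun i ↦ (hz i).mdifferentiableAt).2]
  refine Finset.sum_eq_zero fun i _ ↦ ?_
  ext v
  exact congrArg (fun l ↦ l v) (hz i).mfderiv

end PoissonTensor
end comb
end Smooth

/-! ### Density of regular points -/

section Smooth

variable {E : Type*} [NormedAddCommGroup E] [NormedSpace ℝ E] [FiniteDimensional ℝ E]
  {M : Type*} [TopologicalSpace M] [ChartedSpace E M] [IsManifold 𝓘(ℝ, E) ∞ M]

namespace PoissonTensor

variable {P : PoissonTensor E M}

/-- For covectors in `ker π_#`, this makes `d{h,c}` at `x` depend only on `dh` and `dc` at `x`. It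
holds because `dh([π_# dc, V]) = 0`, where the commutator contains only one term not already zero.
-/
theorem differential_bracket_eq_zero {h c : M → ℝ} {x : M} (hh : CMDiffAt ∞ h x)
    (hc : CMDiffAt ∞ c x) (hhx : differential (E := E) h x = 0) (hcx : P.ham c x = 0) :
    differential (E := E) (P.bracket h c) x = 0 := by
  ext v
  have h1 := differential_mlieBracket hh (mdiffAt_ham (P := P) hc)
    (FiberBundle.mdifferentiableAt_extend 𝓘(ℝ, E) E v)
  rw [hhx, hcx, map_zero, FiberBundle.extend_apply_self] at h1
  rw [bracket_antisymm, differential_neg]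
  change -differential (fun y ↦ differential h y (P.ham c y)) x v = 0
  rw [zero_apply] at h1
  linarith

/-- A point minimizing the dimension of the kernel over an open set is regular. -/
theorem frequently_isRegularAt (x : M) : ∃ᶠ y in 𝓝 x, P.IsRegularAt y := by
  rw [(nhds_basis_opens x).frequently_iff]
  rintro U ⟨hxU, hU⟩
  obtain ⟨y, hy, hmin⟩ := WellFounded.has_min
    (InvImage.wf (fun z ↦ Module.finrank ℝ (P.sharp z).ker) Nat.lt_wfRel.wf) U ⟨x, hxU⟩
  exact ⟨y, hy, by filter_upwards [hU.mem_nhds hy] with z hz using not_lt.1 (hmin z hz)⟩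

theorem eq_zero_of_isRegularAt {F : M → ℝ} {x : M} (hF : ContinuousAt F x)
    (h : ∀ᶠ y in 𝓝 x, P.IsRegularAt y → F y = 0) : F x = 0 := by
  by_contra hx
  obtain ⟨y, hy, h1, h2⟩ := ((frequently_isRegularAt (P := P) x).and_eventually
    (h.and (hF.eventually_ne hx))).exists
  exact h2 (h1 hy)

end PoissonTensor
end Smooth

/-! ### Gram matrices, coframes and the abelian isotropy at regular points -/

section Riemannian

variable {E : Type*} [NormedAddCommGroup E] [NormedSpace ℝ E] [FiniteDimensional ℝ E]
  {M : Type*} [TopologicalSpace M] [ChartedSpace E M] [IsManifold 𝓘(ℝ, E) ∞ M]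
  [RiemannianBundle (fun x : M ↦ TangentSpace 𝓘(ℝ, E) x)]
  [IsContMDiffRiemannianBundle 𝓘(ℝ, E) ∞ E (fun x : M ↦ TangentSpace 𝓘(ℝ, E) x)]
  {ι : Type*} [Fintype ι] [DecidableEq ι]

variable (E) in
/-- The Gram matrix of the differentials of the functions `f i`. -/
def gramMatrix (f : ι → M → ℝ) (x : M) : Matrix ι ι ℝ := .of fun i j ↦ innerDiff (E := E) (f i) (f j) x

theorem isCoframeAt_of_det_ne_zero {f : ι → M → ℝ} {x : M}
    (hcard : Fintype.card ι = Module.finrank ℝ E) (hdet : (gramMatrix E f x).det ≠ 0) :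
    IsCoframeAt E f x := by
  refine ⟨Fintype.linearIndependent_iff.2 fun c hc ↦ congrFun
    (Matrix.eq_zero_of_mulVec_eq_zero hdet ?_), hcard⟩
  funext i
  have h := congrArg (fun l ↦ l (gradient (f i) x)) hc
  simp only [sum_apply, smul_apply, zero_apply, smul_eq_mul, ← innerDiff_eq] at h
  simp only [Matrix.mulVec, dotProduct, gramMatrix, Matrix.of_apply, Pi.zero_apply]
  rw [← h]
  refine Finset.sum_congr rfl fun j _ ↦ ?_
  rw [innerDiff_comm, mul_comm]

theorem continuousAt_gramMatrix {f : ι → M → ℝ} {x : M} (hf : ∀ i, CMDiffAt ∞ (f i) x) :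
    ContinuousAt (gramMatrix E f) x :=
  continuousAt_pi.2 fun i ↦ continuousAt_pi.2 fun j ↦
    (contMDiffAt_innerDiff (hf i) (hf j)).continuousAt

theorem eventually_isCoframeAt {f : ι → M → ℝ} {x : M} (hf : ∀ i, CMDiff ∞ (f i))
    (hcard : Fintype.card ι = Module.finrank ℝ E) (hdet : (gramMatrix E f x).det ≠ 0) :
    ∀ᶠ z in 𝓝 x, IsCoframeAt E f z := by
  have h : ContinuousAt (fun z ↦ (gramMatrix E f z).det) x :=
    (Continuous.matrix_det continuous_id).continuousAt.comp (continuousAt_gramMatrix fun i ↦ hf i x)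
  filter_upwards [h.eventually_ne hdet] with z hz
  exact isCoframeAt_of_det_ne_zero hcard hz

theorem exists_gradient_eq [T2Space M] (x : M) (v : TangentSpace 𝓘(ℝ, E) x) :
    ∃ f : M → ℝ, CMDiff ∞ f ∧ gradient (E := E) f x = v := by
  obtain ⟨f, hf, hfx⟩ := exists_contMDiff_differential_eq (innerSL ℝ v)
  refine ⟨f, hf, ext_inner_right ℝ fun w ↦ ?_⟩
  rw [inner_gradient, hfx, innerSL_apply_apply]

theorem gramMatrix_eq_one {f : ι → M → ℝ} {x : M}
    {e : OrthonormalBasis ι ℝ (TangentSpace 𝓘(ℝ, E) x)} (h : ∀ i, gradient (E := E) (f i) x = e i) :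
    gramMatrix E f x = 1 := by
  ext i j
  change inner ℝ (gradient (E := E) (f i) x) (gradient (E := E) (f j) x) = _
  rw [h, h, orthonormal_iff_ite.1 e.orthonormal, Matrix.one_apply]

namespace PoissonTensor
variable {P : PoissonTensor E M}

/-- Each function is a constant-coefficient combination of a coframe plus a remainder critical at
`x`. The remainders contribute nothing by `differential_bracket_eq_zero`, and the combinations are
covered by `differential_bracket_comb`. -/
theorem IsRegularAt.abelianIsotropy [T2Space M] {x : M} (hx : P.IsRegularAt x) :
    P.AbelianIsotropy x := by
  intro k c hk hc hkx hcx
  let e := stdOrthonormalBasis ℝ (TangentSpace 𝓘(ℝ, E) x)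
  choose f hf hfe using fun i ↦ exists_gradient_eq x (e i)
  have hfx : ∀ᶠ z in 𝓝 x, IsCoframeAt E f z :=
    eventually_isCoframeAt hf (Fintype.card_fin _) (by rw [gramMatrix_eq_one hfe]; simp)
  have hfm (i) : MDiffAt (f i) x := (hf i x).mdifferentiableAt (by simp)
  obtain ⟨a, ha⟩ := hfx.self_of_nhds.exists_comb hfm (differential k x)
  obtain ⟨b, hb⟩ := hfx.self_of_nhds.exists_comb hfm (differential c x)
  have ham_eq {u v : M → ℝ} (h : differential (E := E) u x = differential v x)
      (hv : P.ham v x = 0) : P.ham u x = 0 := by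
    rw [ham_apply, h]
    exact hv
  have md {u : M → ℝ} (h : CMDiff ∞ u) : MDiff u := h.mdifferentiable (by simp)
  have hfa := contMDiff_comb hf a
  have hfb := contMDiff_comb hf b
  have hka : CMDiff ∞ (k - comb f a) := hk.sub hfa
  have hcb : CMDiff ∞ (c - comb f b) := hc.sub hfb
  have h1 := differential_bracket_eq_zero (P := P) (hka x) (hc x)
    ((differential_sub (md hk x) (md hfa x)).trans (by rw [ha, sub_self])) hcx
  have h2 := differential_bracket_eq_zero (P := P) (hcb x) (hfa x)
    ((differential_sub (md hc x) (md hfb x)).trans (by rw [hb, sub_self])) (ham_eq ha hkx)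
  have h3 := differential_bracket_comb hf hx hfx (ham_eq ha hkx) (ham_eq hb hcx)
  have key : P.bracket k c = P.bracket (k - comb f a) c - P.bracket (c - comb f b) (comb f a) +
      P.bracket (comb f a) (comb f b) := by
    rw [bracket_antisymm (c - comb f b)]
    funext y
    change _ = P.bracket _ _ y - -P.bracket _ _ y + P.bracket _ _ y
    simp only [bracket_eq, ham_apply, differential_sub (md hk y) (md hfa y),
      differential_sub (md hc y) (md hfb y), map_sub, sub_apply]
    ring
  have bd {u v : M → ℝ} (hu : CMDiff ∞ u) (hv : CMDiff ∞ v) : MDiffAt (P.bracket u v) x :=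
    (contMDiffAt_bracket (hu x) (hv x)).mdifferentiableAt (by simp)
  rw [key, differential_add ((bd hka hc).sub (bd hcb hfa)) (bd hfa hfb),
    differential_sub (bd hka hc) (bd hcb hfa)]
  rw [h1, h2, h3, sub_zero, add_zero]

end PoissonTensor
end Riemannian

/-! ### The Lie derivative of `π` along the gradient of a Casimir function -/

section Smooth

variable {E : Type*} [NormedAddCommGroup E] [NormedSpace ℝ E] [FiniteDimensional ℝ E]
  {M : Type*} [TopologicalSpace M] [ChartedSpace E M] [IsManifold 𝓘(ℝ, E) ∞ M]

theorem continuousAt_differential_apply {f : M → ℝ} {X : VField E M} {x : M}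
    (hf : CMDiffAt ∞ f x) (hX : CMDiffAt ∞ (T% X) x) :
    ContinuousAt (fun y ↦ differential f y (X y)) x :=
  ((smoothFormAt_differential hf).apply hX).continuousAt

namespace PoissonTensor

variable {P : PoissonTensor E M}

theorem lieDeriv_antisymm (X : VField E M) (β γ : OneForm E M) (x : M) :
    P.lieDeriv X β γ x = -P.lieDeriv X γ β x := by
  rw [lieDeriv, lieDeriv, pair_antisymm γ β, differential_neg, neg_apply,
    pair_antisymm (lieDerivForm X γ) β, pair_antisymm γ]
  change _ = -(_ - -P.pair _ _ x - -P.pair _ _ x)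
  ring

theorem lieDeriv_eq {X : VField E M} {β γ : OneForm E M} {x : M} (hβ : FormMDiffAt β x)
    (hγ : FormMDiffAt γ x) : P.lieDeriv X β γ x =
      γ x (VectorField.mlieBracket 𝓘(ℝ, E) X (P.anchor β) x - P.sharp x (lieDerivForm X β x)) := by
  have h : P.pair β (lieDerivForm X γ) x = differential (P.pair β γ) x (X x)
      - γ x (VectorField.mlieBracket 𝓘(ℝ, E) X (P.anchor β) x) :=
    lieDerivForm_apply hγ (P.mdiffAt_anchor hβ)
  rw [lieDeriv, h, map_sub]
  change _ - γ x (P.sharp x _) - _ = _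
  ring

/-- By `lieDeriv_eq` the value is visibly pointwise in the second form; antisymmetry transfers this
to the first. -/
theorem lieDeriv_congr {X : VField E M} {β γ β' γ' : OneForm E M} {x : M} (hβ : FormMDiffAt β x)
    (hγ : FormMDiffAt γ x) (hβ' : FormMDiffAt β' x) (hγ' : FormMDiffAt γ' x) (hββ' : β x = β' x)
    (hγγ' : γ x = γ' x) : P.lieDeriv X β γ x = P.lieDeriv X β' γ' x := by
  rw [lieDeriv_eq hβ hγ, hγγ', ← lieDeriv_eq hβ hγ', lieDeriv_antisymm, lieDeriv_eq hγ' hβ, hββ',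
    ← lieDeriv_eq hγ' hβ', ← lieDeriv_antisymm]

end PoissonTensor
end Smooth

section Riemannian

variable {E : Type*} [NormedAddCommGroup E] [NormedSpace ℝ E] [FiniteDimensional ℝ E]
  {M : Type*} [TopologicalSpace M] [ChartedSpace E M] [IsManifold 𝓘(ℝ, E) ∞ M]
  [RiemannianBundle (fun x : M ↦ TangentSpace 𝓘(ℝ, E) x)]
  [IsContMDiffRiemannianBundle 𝓘(ℝ, E) ∞ E (fun x : M ↦ TangentSpace 𝓘(ℝ, E) x)]

namespace PoissonTensor
variable {P : PoissonTensor E M}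

theorem continuousAt_conn {f g h : M → ℝ} (hf : CMDiff ∞ f) (hg : CMDiff ∞ g) (hh : CMDiff ∞ h)
    (x : M) : ContinuousAt (fun y ↦ P.conn f g y (gradient h y)) x := by
  have key : (fun y ↦ P.conn f g y (gradient h y)) = fun y ↦ (1 / 2 : ℝ) *
      (differential (E := E) (innerDiff (E := E) g h) y (P.ham f y)
      + differential (E := E) (innerDiff (E := E) f h) y (P.ham g y)
      - differential (E := E) (innerDiff (E := E) f g) y (P.ham h y)
      - differential (E := E) (P.bracket f h) y (gradient g y)
      - differential (E := E) (P.bracket g h) y (gradient f y)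
      + differential (E := E) (P.bracket f g) y (gradient h y)) := by
    funext y
    rw [← two_mul_conn (hf y) (hg y) (hh y)]
    ring
  have hi {u v w : M → ℝ} (hu : CMDiff ∞ u) (hv : CMDiff ∞ v) (hw : CMDiff ∞ w) :
      ContinuousAt (fun y ↦ differential (E := E) (innerDiff (E := E) u v) y (P.ham w y)) x :=
    continuousAt_differential_apply (contMDiffAt_innerDiff (hu x) (hv x)) (contMDiffAt_ham (hw x))
  have hb {u v w : M → ℝ} (hu : CMDiff ∞ u) (hv : CMDiff ∞ v) (hw : CMDiff ∞ w) :
      ContinuousAt (fun y ↦ differential (E := E) (P.bracket u v) y (gradient w y)) x :=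
    continuousAt_differential_apply (contMDiffAt_bracket (hu x) (hv x))
      (contMDiffAt_gradient (hw x))
  rw [key]
  exact (((((hi hg hh hf).add (hi hf hh hg)).sub (hi hf hg hh)).sub (hb hf hh hg)).sub
    (hb hg hh hf)).add (hb hf hg hh) |>.const_mul _

theorem lieDeriv_gradient {f b c : M → ℝ} {x : M} (hf : CMDiffAt ∞ f x) (hb : CMDiffAt ∞ b x)
    (hc : CMDiffAt ∞ c x) :
    P.lieDeriv (gradient f) (differential b) (differential c) x =
      differential (E := E) (P.bracket b c) x (gradient f x)
      + differential (E := E) (innerDiff (E := E) b f) x (P.ham c x)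
      - differential (E := E) (innerDiff (E := E) c f) x (P.ham b x) := by
  have h {b : M → ℝ} (hb : CMDiffAt ∞ b x) : lieDerivForm (gradient f) (differential b) x =
      differential (E := E) (innerDiff (E := E) b f) x := by
    rw [lieDerivForm_differential hb (mdiffAt_gradient hf), funext (innerDiff_eq b f)]
  have h1 : P.pair (lieDerivForm (gradient f) (differential b)) (differential c) x =
      -differential (E := E) (innerDiff (E := E) b f) x (P.ham c x) := by
    rw [← h hb]
    exact P.antisymm x _ _
  have h2 : P.pair (differential b) (lieDerivForm (gradient f) (differential c)) x =
      differential (E := E) (innerDiff (E := E) c f) x (P.ham b x) := by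
    rw [← h hc]
    rfl
  rw [lieDeriv, h1, h2, sub_neg_eq_add]
  rfl

/-- If `f` is a Casimir function near `x`, the Lie derivative of the bivector field along the
gradient of `f` is `-2 D df`. -/
theorem lieDeriv_gradient_of_casimir {f b c : M → ℝ} {x : M} (hf : CMDiffAt ∞ f x)
    (hb : CMDiffAt ∞ b x) (hc : CMDiffAt ∞ c x) (hfx : ∀ᶠ y in 𝓝 x, P.ham f y = 0) :
    P.lieDeriv (gradient f) (differential b) (differential c) x =
      -(2 * P.conn f b x (gradient c x)) := by
  have h (g : M → ℝ) : differential (E := E) (P.bracket f g) x = 0 := by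
    have : P.bracket f g =ᶠ[𝓝 x] 0 := by
      filter_upwards [hfx] with y hy
      rw [bracket_eq, hy, map_zero]
      rfl
    rw [differential_congr this]
    exact mvfderiv_zero
  rw [two_mul_conn hf hb hc, lieDeriv_gradient hf hb hc, h, h, hfx.self_of_nhds,
    innerDiff_comm b f, innerDiff_comm c f]
  simp only [map_zero, zero_apply]
  ring

theorem lieDeriv_gradient_congr {f g : M → ℝ} {b c : M → ℝ} {x : M} (hf : CMDiffAt ∞ f x)
    (hg : CMDiffAt ∞ g x) (hb : CMDiffAt ∞ b x) (hc : CMDiffAt ∞ c x) (hfg : f =ᶠ[𝓝 x] g) :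
    P.lieDeriv (gradient f) (differential b) (differential c) x =
      P.lieDeriv (gradient g) (differential b) (differential c) x := by
  have h1 : ∀ᶠ y in 𝓝 x, differential (E := E) f y = differential g y := by
    filter_upwards [hfg.eventuallyEq_nhds] with y hy using differential_congr hy
  have h2 : gradient (E := E) f x = gradient g x := by
    rw [gradient, metricSharp, h1.self_of_nhds]
    rfl
  have h3 (b : M → ℝ) : innerDiff (E := E) b f =ᶠ[𝓝 x] innerDiff (E := E) b g := by
    filter_upwards [h1] with y hy
    rw [innerDiff_comm, innerDiff_eq, hy, ← innerDiff_eq, innerDiff_comm]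
  rw [lieDeriv_gradient hf hb hc, lieDeriv_gradient hg hb hc, h2, differential_congr (h3 b),
    differential_congr (h3 c)]

theorem IsParallel.lieDeriv_gradient_eq_zero [T2Space M] (hP : P.IsParallel) {U : Set M}
    {f : M → ℝ} (hU : IsOpen U) (hf : CMDiff[U] ∞ f) (hfU : P.IsCasimirOn f U)
    {β γ : OneForm E M} (hβ : SmoothFormOn β U) (hγ : SmoothFormOn γ U) {x : M} (hx : x ∈ U) :
    P.lieDeriv (gradient f) β γ x = 0 := by
  have hUx := hU.mem_nhds hx
  obtain ⟨F, hF, hFf⟩ := exists_contMDiff_eventuallyEq hU hx hf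
  obtain ⟨b, hb, hbx⟩ := exists_contMDiff_differential_eq (β x)
  obtain ⟨c, hc, hcx⟩ := exists_contMDiff_differential_eq (γ x)
  have hβx : SmoothFormAt β x := (hβ x hx).contMDiffAt hUx
  have hγx : SmoothFormAt γ x := (hγ x hx).contMDiffAt hUx
  have hFx : ∀ᶠ y in 𝓝 x, P.ham F y = 0 := by
    filter_upwards [hFf.eventuallyEq_nhds, hUx] with y hy hyU
    rw [ham_apply, differential_congr hy]
    exact hfU y hyU
  rw [lieDeriv_congr hβx.mdiffAt hγx.mdiffAt (smoothFormAt_differential (hb x)).mdiffAt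
    (smoothFormAt_differential (hc x)).mdiffAt hbx.symm hcx.symm,
    lieDeriv_gradient_congr ((hf x hx).contMDiffAt hUx) (hF x) (hb x) (hc x) hFf.symm,
    lieDeriv_gradient_of_casimir (hF x) (hb x) (hc x) hFx]
  -- `F` is a Casimir function on a whole neighbourhood, so `conn_eq_zero` applies at its regular
  -- points, and continuity reaches `x`.
  have : P.conn F b x (gradient c x) = 0 := by
    refine P.eq_zero_of_isRegularAt (continuousAt_conn hF hb hc x) ?_
    filter_upwards [hFx] with y hy hreg
    rw [hP.conn_eq_zero hreg.abelianIsotropy hF hb hy, zero_apply]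
  rw [this, mul_zero, neg_zero]

end PoissonTensor
end Riemannian

/-! ### A trace lemma for skew-symmetric matrices -/

section Trace

variable {ι : Type*} [Fintype ι] [DecidableEq ι]

theorem exists_eq_mul_of_vecMul {J T : Matrix ι ι ℝ}
    (h : ∀ w, Matrix.vecMul w J = 0 → Matrix.vecMul w T = 0) : ∃ R, T = J * R := by
  let col (A : Matrix ι ι ℝ) (j : ι) : (ι → ℝ) →ₗ[ℝ] ℝ := LinearMap.proj j ∘ₗ A.vecMulLinear
  have hmem (k : ι) : col T k ∈ Submodule.span ℝ (Set.range (col J)) := by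
    refine mem_span_of_iInf_ker_le_ker fun w hw ↦ ?_
    refine congrFun (h w (funext fun j ↦ ?_)) k
    exact (Submodule.mem_iInf _).1 hw j
  choose R hR using fun k ↦ (Submodule.mem_span_range_iff_exists_fun ℝ).1 (hmem k)
  refine ⟨.of fun j k ↦ R k j, ?_⟩
  ext i k
  have := congrArg (fun l ↦ l (Pi.single i 1)) (hR k)
  simp [col] at this
  simp [Matrix.mul_apply, ← this, mul_comm]

/-- A matrix `T` with `T * J` symmetric, where `J` is skew-symmetric and the left kernel of `J`
is contained in the left kernel of `T`, is traceless. -/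
theorem trace_eq_zero_of_isSymm_mul {J T : Matrix ι ι ℝ} (hJ : J.transpose = -J)
    (hT : (T * J).IsSymm) (h : ∀ w, Matrix.vecMul w J = 0 → Matrix.vecMul w T = 0) :
    T.trace = 0 := by
  obtain ⟨R, rfl⟩ := exists_eq_mul_of_vecMul h
  -- With `T = J R`, symmetry of `J R J` reads `J R J = J Rᵀ J`. Hence `J (R - Rᵀ)` squares to zero,
  -- and its trace, which is `2 tr (J R)`, vanishes.
  have h1 : J * (R - R.transpose) * J = 0 := by
    have h2 := hT.eq
    rw [Matrix.transpose_mul, Matrix.transpose_mul, hJ] at h2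
    rw [mul_sub, sub_mul, ← h2]
    simp [mul_assoc]
  have h3 : IsNilpotent (J * (R - R.transpose)) := ⟨2, by rw [pow_two, ← mul_assoc, h1, zero_mul]⟩
  have h4 := (Matrix.isNilpotent_trace_of_isNilpotent h3).eq_zero
  have h5 : (J * R.transpose).trace = -(J * R).trace := by
    rw [← Matrix.trace_transpose, Matrix.transpose_mul, Matrix.transpose_transpose, hJ,
      Matrix.trace_mul_comm]
    simp
  rw [mul_sub, Matrix.trace_sub, h5] at h4
  linarith

end Trace

/-! ### The Levi-Civita connection and Hessians -/

section Riemannian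

variable {E : Type*} [NormedAddCommGroup E] [NormedSpace ℝ E] [FiniteDimensional ℝ E]
  {M : Type*} [TopologicalSpace M] [ChartedSpace E M] [IsManifold 𝓘(ℝ, E) ∞ M]
  [RiemannianBundle (fun x : M ↦ TangentSpace 𝓘(ℝ, E) x)]
  [IsContMDiffRiemannianBundle 𝓘(ℝ, E) ∞ E (fun x : M ↦ TangentSpace 𝓘(ℝ, E) x)]

theorem mdiffAt_inner {X Y : VField E M} {x : M} (hX : MDiffAt (T% X) x) (hY : MDiffAt (T% Y) x) :
    MDiffAt (fun y ↦ (inner ℝ (X y) (Y y) : ℝ)) x :=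
  (formMDiffAt_flat hX).apply hY

theorem differential_inner_smul {X Y : VField E M} {f : M → ℝ} {x : M} (hf : MDiffAt f x)
    (hX : MDiffAt (T% X) x) (hY : MDiffAt (T% Y) x) :
    differential (E := E) (fun y ↦ inner ℝ (X y) ((f • Y) y)) x =
      f x • differential (fun y ↦ inner ℝ (X y) (Y y)) x + inner ℝ (X x) (Y x) • differential f x := by
  have : (fun y ↦ (inner ℝ (X y) ((f • Y) y) : ℝ)) = f * fun y ↦ inner ℝ (X y) (Y y) := by
    funext y
    exact inner_smul_right _ _ _
  rw [this, differential_mul hf (mdiffAt_inner hX hY)]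

theorem differential_inner_add {X Y Z : VField E M} {x : M} (hX : MDiffAt (T% X) x)
    (hY : MDiffAt (T% Y) x) (hZ : MDiffAt (T% Z) x) :
    differential (E := E) (fun y ↦ inner ℝ (X y) ((Y + Z) y)) x =
      differential (fun y ↦ inner ℝ (X y) (Y y)) x + differential (fun y ↦ inner ℝ (X y) (Z y)) x := by
  have : (fun y ↦ (inner ℝ (X y) ((Y + Z) y) : ℝ)) =
      (fun y ↦ inner ℝ (X y) (Y y)) + fun y ↦ inner ℝ (X y) (Z y) := by
    funext y
    exact inner_add_right _ _ _
  rw [this, differential_add (mdiffAt_inner hX hY) (mdiffAt_inner hX hZ)]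

theorem tensorialAt_leviCivitaKoszul {X Y : VField E M} {x : M} (hX : MDiffAt (T% X) x)
    (hY : MDiffAt (T% Y) x) :
    TensorialAt 𝓘(ℝ, E) E (fun Z : VField E M ↦ (1 / 2 : ℝ) * leviCivitaKoszul X Y Z x) x := by
  have := FiniteDimensional.complete ℝ E
  constructor
  · intro f Z hf hZ
    simp only [leviCivitaKoszul, VectorField.mlieBracket_smul_right hf hZ,
      differential_inner_smul hf hX hZ, differential_inner_smul hf hY hZ]
    simp only [Pi.smul_apply', add_apply, smul_apply, inner_smul_right, inner_add_left,
      real_inner_smul_left, map_smul, smul_eq_mul, real_inner_comm (Z x)]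
    ring
  · intro Z W hZ hW
    simp only [leviCivitaKoszul, VectorField.mlieBracket_add_right hZ hW,
      differential_inner_add hX hZ hW, differential_inner_add hY hZ hW]
    simp only [Pi.add_apply, add_apply, inner_add_right, inner_add_left, map_add]
    ring

theorem inner_leviCivita {X Y Z : VField E M} {x : M} (hX : MDiffAt (T% X) x)
    (hY : MDiffAt (T% Y) x) (hZ : MDiffAt (T% Z) x) :
    inner ℝ (leviCivita X Y x) (Z x) = (1 / 2 : ℝ) * leviCivitaKoszul X Y Z x := by
  rw [leviCivita, inner_metricSharp, formAt_apply (tensorialAt_leviCivitaKoszul hX hY) hZ]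

theorem leviCivita_add {X Y Z : VField E M} {x : M} (hX : MDiffAt (T% X) x)
    (hY : MDiffAt (T% Y) x) (hZ : MDiffAt (T% Z) x) :
    leviCivita X (Y + Z) x = leviCivita X Y x + leviCivita X Z x := by
  have := FiniteDimensional.complete ℝ E
  refine ext_inner_right ℝ fun v ↦ ?_
  have hV := FiberBundle.mdifferentiableAt_extend 𝓘(ℝ, E) E v
  rw [← FiberBundle.extend_apply_self (F := E) v, inner_add_left,
    inner_leviCivita hX (mdifferentiableAt_add_section hY hZ) hV, inner_leviCivita hX hY hV, inner_leviCivita hX hZ hV]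
  generalize FiberBundle.extend E v = V at hV
  have hc (W : VField E M) : (fun y ↦ (inner ℝ (W y) (V y) : ℝ)) = fun y ↦ inner ℝ (V y) (W y) :=
    funext fun y ↦ real_inner_comm _ _
  simp only [leviCivitaKoszul, VectorField.mlieBracket_add_right hY hZ,
    VectorField.mlieBracket_add_left hY hZ, hc, differential_inner_add hX hY hZ,
    differential_inner_add hV hY hZ]
  simp only [Pi.add_apply, add_apply, inner_add_right, inner_add_left, map_add]
  ring

theorem leviCivita_smul {X Y : VField E M} {f : M → ℝ} {x : M} (hf : MDiffAt f x)
    (hX : MDiffAt (T% X) x) (hY : MDiffAt (T% Y) x) :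
    leviCivita X (f • Y) x = f x • leviCivita X Y x + differential f x (X x) • Y x := by
  have := FiniteDimensional.complete ℝ E
  refine ext_inner_right ℝ fun v ↦ ?_
  have hV := FiberBundle.mdifferentiableAt_extend 𝓘(ℝ, E) E v
  rw [← FiberBundle.extend_apply_self (F := E) v, inner_add_left, real_inner_smul_left,
    inner_leviCivita hX (hf.smul_section hY) hV, inner_leviCivita hX hY hV]
  generalize FiberBundle.extend E v = V at hV
  have hc (W : VField E M) : (fun y ↦ (inner ℝ (W y) (V y) : ℝ)) = fun y ↦ inner ℝ (V y) (W y) :=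
    funext fun y ↦ real_inner_comm _ _
  simp only [leviCivitaKoszul, VectorField.mlieBracket_smul_right hf hY,
    VectorField.mlieBracket_smul_left hf hY, hc, differential_inner_smul hf hX hY,
    differential_inner_smul hf hV hY]
  simp only [Pi.smul_apply', add_apply, smul_apply, inner_smul_right, inner_add_left, neg_smul, inner_neg_left,
      real_inner_smul_left, map_smul, smul_eq_mul]
  rw [real_inner_comm (X x) (Y x), real_inner_comm (V x) (Y x)]
  ring

theorem tensorialAt_leviCivitaForm {X : VField E M} {α : OneForm E M} {x : M}
    (hX : MDiffAt (T% X) x) (hα : FormMDiffAt α x) :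
    TensorialAt 𝓘(ℝ, E) E (fun Y : VField E M ↦ differential (fun y ↦ α y (Y y)) x (X x)
      - α x (leviCivita X Y x)) x := by
  constructor
  · intro f Y hf hY
    rw [leviCivita_smul hf hX hY]
    have h1 : (fun y ↦ α y ((f • Y) y)) = f * fun y ↦ α y (Y y) := by
      funext y
      simp
    rw [h1, differential_mul hf (hα.apply hY)]
    simp
    ring
  · intro Y Z hY hZ
    rw [leviCivita_add hX hY hZ]
    have h1 : (fun y ↦ α y ((Y + Z) y)) = (fun y ↦ α y (Y y)) + fun y ↦ α y (Z y) := by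
      funext y
      simp
    rw [h1, differential_add (hα.apply hY) (hα.apply hZ)]
    simp
    ring

theorem leviCivitaForm_apply {X Y : VField E M} {α : OneForm E M} {x : M} (hX : MDiffAt (T% X) x)
    (hα : FormMDiffAt α x) (hY : MDiffAt (T% Y) x) :
    leviCivitaForm X α x (Y x) = differential (fun y ↦ α y (Y y)) x (X x)
      - α x (leviCivita X Y x) :=
  formAt_apply (tensorialAt_leviCivitaForm hX hα) hY

/-- The Hessian of `f`, expressed through the Lie derivative of the metric along `∇f`. -/
theorem two_mul_leviCivitaForm_differential {X Y : VField E M} {f : M → ℝ} {x : M}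
    (hX : MDiffAt (T% X) x) (hf : CMDiffAt ∞ f x) (hY : MDiffAt (T% Y) x) :
    2 * leviCivitaForm X (differential f) x (Y x) =
      differential (fun y ↦ inner ℝ (X y) (Y y)) x (gradient (E := E) f x)
      + inner ℝ (VectorField.mlieBracket 𝓘(ℝ, E) X (gradient f) x) (Y x)
      + inner ℝ (VectorField.mlieBracket 𝓘(ℝ, E) Y (gradient f) x) (X x) := by
  have hc (W : VField E M) : (fun y ↦ (inner ℝ (W y) (gradient f y) : ℝ)) =
      fun y ↦ differential f y (W y) :=
    funext fun y ↦ by rw [real_inner_comm, inner_gradient]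
  rw [leviCivitaForm_apply hX (smoothFormAt_differential hf).mdiffAt hY, ← inner_gradient f x,
    real_inner_comm, inner_leviCivita hX hY (mdiffAt_gradient hf), leviCivitaKoszul, hc, hc,
    real_inner_comm, inner_gradient, differential_mlieBracket hf hX hY]
  ring

theorem leviCivitaForm_differential_comm {X Y : VField E M} {f : M → ℝ} {x : M}
    (hX : MDiffAt (T% X) x) (hf : CMDiffAt ∞ f x) (hY : MDiffAt (T% Y) x) :
    leviCivitaForm X (differential f) x (Y x) = leviCivitaForm Y (differential f) x (X x) := by
  have h1 := two_mul_leviCivitaForm_differential hX hf hY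
  have h2 := two_mul_leviCivitaForm_differential hY hf hX
  have h3 : (fun y ↦ (inner ℝ (X y) (Y y) : ℝ)) = fun y ↦ inner ℝ (Y y) (X y) :=
    funext fun y ↦ real_inner_comm _ _
  rw [h3] at h1
  linarith

/-- Symmetry of the Hessian moves `X` to the slot where the expression is pointwise by construction.
-/
theorem leviCivitaForm_differential_congr {X X' : VField E M} {f : M → ℝ} {x : M}
    (hX : MDiffAt (T% X) x) (hX' : MDiffAt (T% X') x) (hf : CMDiffAt ∞ f x) (h : X x = X' x) :
    leviCivitaForm X (differential f) x = leviCivitaForm X' (differential f) x := by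
  ext v
  have hV := FiberBundle.mdifferentiableAt_extend 𝓘(ℝ, E) E v
  rw [← FiberBundle.extend_apply_self (F := E) v, leviCivitaForm_differential_comm hX hf hV, h,
    ← leviCivitaForm_differential_comm hX' hf hV]

theorem two_mul_leviCivitaForm_gradient {f g h : M → ℝ} {x : M} (hf : CMDiffAt ∞ f x)
    (hg : CMDiffAt ∞ g x) (hh : CMDiffAt ∞ h x) :
    2 * leviCivitaForm (E := E) (gradient g) (differential f) x (gradient h x) =
      differential (E := E) (innerDiff (E := E) f h) x (gradient g x)
      + differential (E := E) (innerDiff (E := E) f g) x (gradient h x)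
      - differential (E := E) (innerDiff (E := E) g h) x (gradient f x) := by
  have hb {u v : M → ℝ} (hu : CMDiffAt ∞ u x) (hv : CMDiffAt ∞ v x) :
      inner ℝ (VectorField.mlieBracket 𝓘(ℝ, E) (gradient u) (gradient f) x) (gradient v x) =
        differential (E := E) (innerDiff (E := E) f v) x (gradient u x)
        - differential (E := E) (innerDiff (E := E) u v) x (gradient f x) := by
    rw [real_inner_comm, inner_gradient, differential_mlieBracket hv (mdiffAt_gradient hu)
      (mdiffAt_gradient hf), innerDiff_comm f v, innerDiff_comm u v, funext (innerDiff_eq v f),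
      funext (innerDiff_eq v u)]
  rw [two_mul_leviCivitaForm_differential (mdiffAt_gradient hg) hf (mdiffAt_gradient hh),
    hb hg hh, hb hh hg, innerDiff_comm h g]
  change differential (innerDiff (E := E) g h) x _ + _ + _ = _
  ring

namespace PoissonTensor
variable {P : PoissonTensor E M}

theorem covDeriv_antisymm (X : VField E M) (β γ : OneForm E M) (x : M) :
    P.covDeriv X β γ x = -P.covDeriv X γ β x := by
  rw [covDeriv, covDeriv, pair_antisymm γ β, differential_neg, neg_apply,
    pair_antisymm (leviCivitaForm X γ) β, pair_antisymm γ]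
  change _ = -(_ - -P.pair _ _ x - -P.pair _ _ x)
  ring

theorem covDeriv_eq {X : VField E M} {β γ : OneForm E M} {x : M} (hX : MDiffAt (T% X) x)
    (hβ : FormMDiffAt β x) (hγ : FormMDiffAt γ x) : P.covDeriv X β γ x =
      γ x (leviCivita X (P.anchor β) x - P.sharp x (leviCivitaForm X β x)) := by
  have h : P.pair β (leviCivitaForm X γ) x = differential (P.pair β γ) x (X x)
      - γ x (leviCivita X (P.anchor β) x) :=
    leviCivitaForm_apply hX hγ (P.mdiffAt_anchor hβ)
  rw [covDeriv, h, map_sub]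
  change _ - γ x (P.sharp x _) - _ = _
  ring

theorem covDeriv_congr {X : VField E M} {β γ β' γ' : OneForm E M} {x : M} (hX : MDiffAt (T% X) x)
    (hβ : FormMDiffAt β x) (hγ : FormMDiffAt γ x) (hβ' : FormMDiffAt β' x)
    (hγ' : FormMDiffAt γ' x) (hββ' : β x = β' x)
    (hγγ' : γ x = γ' x) : P.covDeriv X β γ x = P.covDeriv X β' γ' x := by
  rw [covDeriv_eq hX hβ hγ, hγγ', ← covDeriv_eq hX hβ hγ', covDeriv_antisymm,
    covDeriv_eq hX hγ' hβ, hββ', ← covDeriv_eq hX hγ' hβ', ← covDeriv_antisymm]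

theorem covDeriv_differential {X : VField E M} {f b : M → ℝ} {x : M} (hX : MDiffAt (T% X) x)
    (hf : CMDiffAt ∞ f x) (hb : CMDiffAt ∞ b x) (hfx : X x = gradient (E := E) f x) :
    P.covDeriv X (differential f) (differential b) x =
      differential (P.bracket f b) x (gradient (E := E) f x)
      + leviCivitaForm (E := E) (gradient f) (differential f) x (P.ham b x)
      - leviCivitaForm (E := E) (gradient f) (differential b) x (P.ham f x) := by
  have h1 : P.pair (leviCivitaForm X (differential f)) (differential b) x =
      -leviCivitaForm X (differential f) x (P.ham b x) := P.antisymm x _ _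
  rw [covDeriv, h1, hfx, leviCivitaForm_differential_congr hX (mdiffAt_gradient hf) hf hfx,
    sub_neg_eq_add]
  congr 1
  change leviCivitaForm X (differential b) x (P.ham f x) = _
  rw [leviCivitaForm_differential_congr hX (mdiffAt_gradient hf) hb hfx]

end PoissonTensor
end Riemannian

/-! ### The divergence as a trace of the contravariant connection -/

section Riemannian

variable {E : Type*} [NormedAddCommGroup E] [NormedSpace ℝ E] [FiniteDimensional ℝ E]
  {M : Type*} [TopologicalSpace M] [ChartedSpace E M] [IsManifold 𝓘(ℝ, E) ∞ M]
  [RiemannianBundle (fun x : M ↦ TangentSpace 𝓘(ℝ, E) x)]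
  [IsContMDiffRiemannianBundle 𝓘(ℝ, E) ∞ E (fun x : M ↦ TangentSpace 𝓘(ℝ, E) x)]
  {ι : Type*} [Fintype ι]

namespace PoissonTensor
variable {P : PoissonTensor E M}

/-- The covectors `D_{df i} db`, evaluated on the gradients of the functions `f j`. -/
def connMatrix (P : PoissonTensor E M) (f : ι → M → ℝ) (b : M → ℝ) (x : M) : Matrix ι ι ℝ :=
  .of fun i j ↦ P.conn (f i) b x (gradient (f j) x)

theorem conn_comb {f : ι → M → ℝ} (hf : ∀ i, CMDiff ∞ (f i)) (w : ι → ℝ) {b h : M → ℝ}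
    (hb : CMDiff ∞ b) (hh : CMDiff ∞ h) (x : M) :
    P.conn (comb f w) b x (gradient (E := E) h x) =
      ∑ i, w i * P.conn (f i) b x (gradient (E := E) h x) := by
  have hfd (i : ι) : MDiff (f i) := (hf i).mdifferentiable (by simp)
  have comb_apply (g : ι → M → ℝ) (y : M) : comb g w y = ∑ i, w i * g i y := by simp [comb]
  have hi (h : M → ℝ) : innerDiff (E := E) (comb f w) h = comb (fun i ↦ innerDiff (E := E) (f i) h) w := by
    funext y
    simp [innerDiff_eq, differential_comb (fun i ↦ hfd i y), comb_apply]
  have hbr (h : M → ℝ) : P.bracket (comb f w) h = comb (fun i ↦ P.bracket (f i) h) w := by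
    funext y
    simp [bracket_comb_left hfd, comb_apply]
  have hg : gradient (E := E) (comb f w) x = ∑ i, w i • gradient (f i) x := by
    refine ext_inner_right ℝ fun v ↦ ?_
    simp [inner_gradient, differential_comb (fun i ↦ hfd i x), sum_inner, real_inner_smul_left]
  have hmi {h : M → ℝ} (hh : CMDiff ∞ h) (i : ι) : MDiffAt (innerDiff (E := E) (f i) h) x :=
    (contMDiffAt_innerDiff (hf i x) (hh x)).mdifferentiableAt (by simp)
  have hmb {h : M → ℝ} (hh : CMDiff ∞ h) (i : ι) : MDiffAt (P.bracket (f i) h) x :=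
    (contMDiffAt_bracket (hf i x) (hh x)).mdifferentiableAt (by simp)
  have h2 := two_mul_conn (P := P) (contMDiff_comb hf w x) (hb x) (hh x)
  rw [hi, hi, hbr, hbr, differential_comb (hmi hh), differential_comb (hmi hb),
    differential_comb (hmb hh), differential_comb (hmb hb), hg,
    ham_comb fun i ↦ hfd i x] at h2
  simp only [sum_apply, smul_apply, map_sum, map_smul, smul_eq_mul] at h2
  refine mul_left_cancel₀ (two_ne_zero (α := ℝ)) (h2.trans ?_)
  rw [← Finset.sum_add_distrib, ← Finset.sum_sub_distrib, ← Finset.sum_sub_distrib,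
    ← Finset.sum_sub_distrib, ← Finset.sum_add_distrib, Finset.mul_sum]
  refine Finset.sum_congr rfl fun i _ ↦ ?_
  rw [mul_left_comm, two_mul_conn (hf i x) (hb x) (hh x)]
  ring

variable [DecidableEq ι]

/-- Moving `b` to the first slot by vanishing torsion turns the difference of the two sides into the
parallelism identity for `D_{db}`; the remaining bracket terms cancel by Jacobi. -/
theorem IsParallel.conn_ham_comm (hP : P.IsParallel) {f g b : M → ℝ} (hf : CMDiff ∞ f)
    (hg : CMDiff ∞ g) (hb : CMDiff ∞ b) (x : M) :
    P.conn f b x (P.ham g x) = P.conn g b x (P.ham f x) := by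
  have h1 := congrArg (fun l ↦ l (P.ham g x)) (conn_sub_conn (P := P) (hf x) (hb x))
  have h2 := congrArg (fun l ↦ l (P.ham f x)) (conn_sub_conn (P := P) (hb x) (hg x))
  have h3 := hP.conn_ham hb hg hf x
  have h4 := P.jacobi_bracket hf hb hg x
  simp only [sub_apply] at h1 h2
  rw [bracket_antisymm g f, differential_neg, neg_apply] at h4
  rw [bracket_antisymm g f, differential_neg, neg_apply] at h3
  linarith

/-- If `T` is the matrix of `α ↦ D_α db` in the coframe and `G` the Gram matrix, then `connMatrix =
T G`, so the product with the adjugate is `det G • T`. The adjugate, unlike the inverse, is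
polynomial in `G`, so its continuity is immediate. -/
theorem IsParallel.trace_connMatrix_mul_adjugate [T2Space M] (hP : P.IsParallel) {f : ι → M → ℝ}
    (hf : ∀ i, CMDiff ∞ (f i)) {b : M → ℝ} (hb : CMDiff ∞ b) {x : M} (hx : P.AbelianIsotropy x)
    (hfx : IsCoframeAt E f x) (hdet : (gramMatrix E f x).det ≠ 0) :
    (P.connMatrix f b x * (gramMatrix E f x).adjugate).trace = 0 := by
  have hfd (i : ι) : MDiffAt (f i) x := (hf i x).mdifferentiableAt (by simp)
  choose T hT using fun i ↦ hfx.exists_comb hfd (P.conn (f i) b x)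
  have hT' (i : ι) (v : TangentSpace 𝓘(ℝ, E) x) :
      P.conn (f i) b x v = ∑ k, T i k * differential (f k) x v := by
    rw [← hT i, differential_comb hfd]
    simp
  have hM : P.connMatrix f b x = Matrix.of T * gramMatrix E f x := by
    ext i j
    simp [connMatrix, gramMatrix, Matrix.mul_apply, hT', innerDiff_eq]
  have hJ : (P.bracketMatrix f x).transpose = -P.bracketMatrix f x := by
    ext i j
    exact congrFun (bracket_antisymm (f j) (f i)) x
  have hTJ (i j : ι) : (Matrix.of T * P.bracketMatrix f x) i j = -P.conn (f i) b x (P.ham (f j) x) := by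
    rw [hT', Matrix.mul_apply, ← Finset.sum_neg_distrib]
    refine Finset.sum_congr rfl fun k _ ↦ ?_
    rw [← mul_neg]
    exact congrArg (T i k * ·) (congrFun (bracket_antisymm (f k) (f j)) x)
  have hsymm : (Matrix.of T * P.bracketMatrix f x).IsSymm := by
    ext i j
    rw [Matrix.transpose_apply, hTJ, hTJ, hP.conn_ham_comm (hf j) (hf i) hb]
  have htr : (Matrix.of T).trace = 0 := by
    refine trace_eq_zero_of_isSymm_mul hJ hsymm fun w hw ↦ ?_
    have hham : P.ham (comb f w) x = 0 := by
      refine hfx.eq_zero fun j ↦ ?_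
      rw [ham_comb hfd, map_sum]
      refine Eq.trans (Finset.sum_congr rfl fun i _ ↦ ?_) (congrFun hw j)
      rw [map_smul]
      rfl
    have hMw : Matrix.vecMul w (P.connMatrix f b x) = 0 := by
      funext j
      have := conn_comb (P := P) hf w hb (hf j) x
      rw [hP.conn_eq_zero hx (contMDiff_comb hf w) hb hham, zero_apply] at this
      exact this.symm
    rw [hM, ← Matrix.vecMul_vecMul] at hMw
    exact Matrix.eq_zero_of_vecMul_eq_zero hdet hMw
  rw [hM, mul_assoc, Matrix.mul_adjugate, Matrix.mul_smul, mul_one, Matrix.trace_smul, htr, smul_zero]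

theorem IsParallel.sum_conn_eq_zero [T2Space M] (hP : P.IsParallel) {x : M} {f : ι → M → ℝ}
    (hf : ∀ i, CMDiff ∞ (f i)) {b : M → ℝ} (hb : CMDiff ∞ b)
    (e : OrthonormalBasis ι ℝ (TangentSpace 𝓘(ℝ, E) x)) (hfe : ∀ i, gradient (f i) x = e i) :
    ∑ i, P.conn (f i) b x (gradient (f i) x) = 0 := by
  have hG := gramMatrix_eq_one hfe
  have hcard : Fintype.card ι = Module.finrank ℝ E :=
    (Module.finrank_eq_card_basis e.toBasis).symm
  have hc : ContinuousAt
      (fun y ↦ (P.connMatrix f b y * (gramMatrix E f y).adjugate).trace) x := by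
    have h1 : ContinuousAt (P.connMatrix f b) x := continuousAt_pi.2 fun i ↦
      continuousAt_pi.2 fun j ↦ continuousAt_conn (hf i) hb (hf j) x
    have h2 : ContinuousAt (gramMatrix E f) x := continuousAt_gramMatrix fun i ↦ hf i x
    exact ((Continuous.matrix_trace (continuous_fst.matrix_mul
      continuous_snd.matrix_adjugate)).continuousAt (x := (P.connMatrix f b x, gramMatrix E f x))).comp
      (f := fun y ↦ (P.connMatrix f b y, gramMatrix E f y)) (h1.prodMk h2)
  have hdet : ∀ᶠ y in 𝓝 x, (gramMatrix E f y).det ≠ 0 := by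
    refine ((Continuous.matrix_det continuous_id).continuousAt.comp
      (continuousAt_gramMatrix fun i ↦ hf i x)).eventually_ne ?_
    simp [hG]
  have h := P.eq_zero_of_isRegularAt hc (by
    filter_upwards [hdet] with y hy hreg
    exact hP.trace_connMatrix_mul_adjugate hf hb hreg.abelianIsotropy
      (isCoframeAt_of_det_ne_zero hcard hy) hy)
  rw [hG, Matrix.adjugate_one, mul_one] at h
  exact h

theorem divergence_eq_sum_conn [T2Space M] {β : OneForm E M} {b : M → ℝ} {x : M}
    (hβ : SmoothFormAt β x) (hb : CMDiff ∞ b) (hbx : differential b x = β x)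
    {f : Fin (Module.finrank ℝ (TangentSpace 𝓘(ℝ, E) x)) → M → ℝ} (hf : ∀ i, CMDiff ∞ (f i))
    (hfe : ∀ i, gradient (f i) x = stdOrthonormalBasis ℝ (TangentSpace 𝓘(ℝ, E) x) i) :
    P.divergence β x = ∑ i, P.conn (f i) b x (gradient (f i) x) := by
  set e := stdOrthonormalBasis ℝ (TangentSpace 𝓘(ℝ, E) x) with he
  -- An auxiliary function whose gradient at `x` is `π_# db`, so that the Hessian formula for
  -- gradients can be evaluated on that vector.
  obtain ⟨h, hh, hhx⟩ := exists_gradient_eq x (P.ham b x)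
  have hterm (i) : P.covDeriv (FiberBundle.extend E (e i)) (flat (FiberBundle.extend E (e i))) β x =
      P.conn (f i) b x (gradient (f i) x)
      - leviCivitaForm (E := E) (gradient (f i)) (differential b) x (P.ham (f i) x) := by
    have hX := FiberBundle.mdifferentiableAt_extend 𝓘(ℝ, E) E (e i)
    have hXx : FiberBundle.extend E (e i) x = gradient (E := E) (f i) x := by
      rw [FiberBundle.extend_apply_self, hfe]
    have hfl : flat (FiberBundle.extend E (e i)) x = differential (f i) x := by
      ext v
      rw [flat_apply, hXx, inner_gradient]
    rw [covDeriv_congr hX (formMDiffAt_flat hX) hβ.mdiffAt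
      (smoothFormAt_differential (hf i x)).mdiffAt (smoothFormAt_differential (hb x)).mdiffAt
      hfl hbx.symm, covDeriv_differential hX (hf i x) (hb x) hXx]
    congr 1
    have h1 := two_mul_leviCivitaForm_gradient (hf i x) (hf i x) (hh x)
    have h2 := two_mul_conn (P := P) (hf i x) (hb x) (hf i x)
    rw [hhx] at h1
    rw [innerDiff_comm b (f i), bracket_antisymm b (f i)] at h2
    have h3 : differential (E := E) (P.bracket (f i) (f i)) x = 0 := by
      ext v
      have := congrArg (fun u ↦ differential (E := E) u x v) (bracket_antisymm (P := P) (f i) (f i))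
      simp only [differential_neg, neg_apply] at this
      exact self_eq_neg.1 this
    simp only [differential_neg, neg_apply, h3, zero_apply] at h2
    linarith
  -- Full contraction of the symmetric Hessian of `b` with the antisymmetric `π`: exchanging the
  -- summation indices changes the sign.
  have hsum : ∑ i, leviCivitaForm (E := E) (gradient (f i)) (differential b) x (P.ham (f i) x) = 0 := by
    have hA (i) : P.ham (f i) x = ∑ j, P.bracket (f i) (f j) x • gradient (f j) x := by
      rw [← e.sum_repr' (P.ham (f i) x)]
      refine Finset.sum_congr rfl fun j _ ↦ ?_
      rw [← hfe, inner_gradient]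
      rfl
    have hS : ∑ i, leviCivitaForm (E := E) (gradient (f i)) (differential b) x (P.ham (f i) x) =
        ∑ i, ∑ j, P.bracket (f i) (f j) x *
          leviCivitaForm (E := E) (gradient (f i)) (differential b) x (gradient (f j) x) := by
      refine Finset.sum_congr rfl fun i _ ↦ ?_
      rw [hA, map_sum]
      simp
    rw [hS]
    refine self_eq_neg.1 ?_
    conv_lhs => rw [Finset.sum_comm]
    rw [← Finset.sum_neg_distrib]
    refine Finset.sum_congr rfl fun i _ ↦ ?_
    rw [← Finset.sum_neg_distrib]
    refine Finset.sum_congr rfl fun j _ ↦ ?_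
    rw [leviCivitaForm_differential_comm (mdiffAt_gradient (hf j x)) (hb x)
      (mdiffAt_gradient (hf i x)), bracket_antisymm (f j) (f i)]
    exact neg_mul _ _
  rw [divergence]
  simp only [← he, hterm, Finset.sum_sub_distrib, hsum, sub_zero]

theorem IsParallel.divergence_eq_zero [T2Space M] (hP : P.IsParallel) {β : OneForm E M} {x : M}
    (hβ : SmoothFormAt β x) : P.divergence β x = 0 := by
  obtain ⟨b, hb, hbx⟩ := exists_contMDiff_differential_eq (β x)
  choose f hf hfe using fun i ↦ exists_gradient_eq x
    (stdOrthonormalBasis ℝ (TangentSpace 𝓘(ℝ, E) x) i)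
  rw [divergence_eq_sum_conn hβ hb hbx hf hfe, hP.sum_conn_eq_zero hf hb _ hfe]

end PoissonTensor
end Riemannian

end

end KillingPoisson

theorem theorem1p3 {E : Type*} [NormedAddCommGroup E] [NormedSpace ℝ E] [FiniteDimensional ℝ E]
    {M : Type*} [TopologicalSpace M] [T2Space M] [ChartedSpace E M] [IsManifold 𝓘(ℝ, E) ∞ M]
    [RiemannianBundle (fun x : M ↦ TangentSpace 𝓘(ℝ, E) x)]
    [IsContMDiffRiemannianBundle 𝓘(ℝ, E) ∞ E (fun x : M ↦ TangentSpace 𝓘(ℝ, E) x)]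
    (P : KillingPoisson.PoissonTensor E M) (hP : P.IsParallel) :
    P.IsKillingPoisson where
  divergence_eq_zero _ hβ x := hP.divergence_eq_zero ((hβ x trivial).contMDiffAt Filter.univ_mem)
  lieDeriv_gradient_eq_zero _ _ hU hf hfU _ _ hβ hγ _ hx :=
    hP.lieDeriv_gradient_eq_zero hU hf hfU hβ hγ hx
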